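/- Let $\mathrm{Gr}(1,3)$ be the manifold of projective lines $l\subset\mathbb{CP}^3=\mathbb P(\mathbb C^4)$, i.e. of two-dimensional subspaces $V\subset\mathbb C^4$, with the Kähler form $\omega$ obtained by pulling back the Fubini–Study form of $\mathbb P(\Lambda^2\mathbb C^4)$ (normalized as $i\,\partial\bar\partial\log|w|^2$) under the Plücker embedding. Let $e_0,\dots,e_3$ be the standard orthonormal basis of $\mathbb C^4$, let $p_0,\dots,p_3\in\mathbb{CP}^3$ be the corresponding points, let $\langle\cdot\rangle$ denote projective hull, and put $$\tilde\mu_i(l)=\max_{0\ne v\in V}\frac{|\langle e_i,v\rangle|^2}{|v|^2},\qquad \mathrm{Gr}^0(1,3)=\{\,l:\ \tilde\mu_0(l)>0,\ \tilde\mu_1(l)>0,\ \tilde\mu_0(l)+\tilde\mu_1(l)<1\,\},$$ $$\Delta=\{(c_0,c_1)\in\mathbb R^2:\ c_0>0,\ c_1>0,\ c_0+c_1<1\}.$$ **Proposition 1.** (a) The torus $T^2=U(1)\times U(1)$, acting on $\mathrm{Gr}(1,3)$ through $(z_0,z_1,z_2,z_3)\mapsto(t_0z_0,t_1z_1,z_2,z_3)$,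 acts smoothly, and its two coordinate circles $\theta\mapsto(e^{i\theta},1)$ and $\theta\mapsto(1,e^{i\theta})$ act by the flows of Hamiltonian vector fields of $\tilde\mu_0$ and $\tilde\mu_1$ with respect to $\omega$ (with the convention $df(Y)=\omega(Y,X_f)$). (b) $\mathrm{Gr}^0(1,3)$ is open, and there is a map $\tau=(s_0,s_1):\mathrm{Gr}^0(1,3)\to\langle p_2,p_3\rangle\times\langle p_2,p_3\rangle$ given by $\{s_i(l)\}=\langle p_i,l\rangle\cap\langle p_2,p_3\rangle$ for $i=0,1$. It is a smooth locally trivial fibration with fibre $\Delta\times T^2$: every point of the base has an open neighbourhood $U$ with a diffeomorphism $\tau^{-1}(U)\cong U\times\Delta\times T^2$ whose first component is $\tau$, whose second component is $(\tilde\mu_0,\tilde\mu_1)$, and whose third component is $T^2$-equivariant ($T^2$ acting on itself by translations). (c) The $T^2$-action preserves $\mathrm{Gr}^0(1,3)$, fixes every point of the base and maps each fibre of $\tau$ to itself: $\tau(t\cdot l)=\tau(l)$ for all $t\in T^2$, $l\in\mathrm{Gr}^0(1,3)$. (d) For every $b\in\langle p_2,p_3\rangle\times\langle p_2,p_3\rangle$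 and every $(c_0,c_1)\in\Delta$, the joint level set $\{l\in\tau^{-1}(b):\ \tilde\mu_0(l)=c_0,\ \tilde\mu_1(l)=c_1\}$ is the image of a $T^2$-equivariant smooth embedding $T^2\to\mathrm{Gr}(1,3)$, that is, a smoothly embedded $T^2$-invariant two-dimensional torus. -/

import Mathlib

open scoped Manifold ContDiff
open Set Module

noncomputable section

namespace LineGrass

/-! ### The manifold of `k`-dimensional subspaces of a `(k + m)`-dimensional complex space -/

/-- The Grassmannian of `k`-dimensional linear subspaces of the `(k + m)`-dimensional complex
vector space `E`, i.e. of `(k - 1)`-dimensional projective subspaces of `ℙ(E)`. -/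
@[ext]
structure Grass (k m : ℕ) (E : Type*) [AddCommGroup E] [Module ℂ E] where
  toSubmodule : Submodule ℂ E
  finrank_eq : finrank ℂ toSubmodule = k

/-- The model space `Hom(ℂᵏ, ℂᵐ)` of the Grassmannian. -/
abbrev Model (k m : ℕ) : Type := (Fin k → ℂ) →L[ℂ] (Fin m → ℂ)

section Charts

variable {k m : ℕ} {E : Type*} [AddCommGroup E] [Module ℂ E]

/-- For a linear splitting `g : ℂᵏ × ℂᵐ ≃ E` and `A : ℂᵏ → ℂᵐ`, the map `x ↦ g (x, A x)`. -/
def graphMap (g : ((Fin k → ℂ) × (Fin m → ℂ)) ≃ₗ[ℂ] E) (A : Model k m) :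
    (Fin k → ℂ) →ₗ[ℂ] E :=
  g.toLinearMap ∘ₗ LinearMap.prod LinearMap.id A.toLinearMap

@[simp] theorem graphMap_apply (g : ((Fin k → ℂ) × (Fin m → ℂ)) ≃ₗ[ℂ] E) (A : Model k m)
    (x : Fin k → ℂ) : graphMap g A x = g (x, A x) := rfl

theorem graphMap_injective (g : ((Fin k → ℂ) × (Fin m → ℂ)) ≃ₗ[ℂ] E) (A : Model k m) :
    Function.Injective (graphMap g A) := by
  intro x y h
  have h' : (x, A x) = (y, A y) := g.injective h
  exact (Prod.ext_iff.1 h').1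

/-- The image under `g` of the graph of `A`. -/
def graphSub (g : ((Fin k → ℂ) × (Fin m → ℂ)) ≃ₗ[ℂ] E) (A : Model k m) : Grass k m E where
  toSubmodule := LinearMap.range (graphMap g A)
  finrank_eq := by
    rw [LinearMap.finrank_range_of_inj (graphMap_injective g A)]; simp

theorem mem_graphSub (g : ((Fin k → ℂ) × (Fin m → ℂ)) ≃ₗ[ℂ] E) (A : Model k m) (v : E) :
    v ∈ (graphSub g A).toSubmodule ↔ (g.symm v).2 = A (g.symm v).1 := by
  constructor
  · rintro ⟨x, rfl⟩; simp
  · intro h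
    refine ⟨(g.symm v).1, ?_⟩
    rw [graphMap_apply, ← h]; simp

theorem graphSub_injective (g : ((Fin k → ℂ) × (Fin m → ℂ)) ≃ₗ[ℂ] E) :
    Function.Injective (graphSub g) := by
  intro A B h
  ext1 x
  have : g (x, A x) ∈ (graphSub g B).toSubmodule := by
    rw [← h]; exact ⟨x, rfl⟩
  simpa using (mem_graphSub g B _).1 this

/-- The affine chart attached to a splitting `g`: it sends the image under `g` of the graph of `A`
to `A`. -/
def graphChart (g : ((Fin k → ℂ) × (Fin m → ℂ)) ≃ₗ[ℂ] E) :
    PartialEquiv (Grass k m E) (Model k m) where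
  toFun := Function.invFun (graphSub g)
  invFun := graphSub g
  source := range (graphSub g)
  target := univ
  map_source' _ _ := mem_univ _
  map_target' A _ := mem_range_self A
  left_inv' _ hV := Function.invFun_eq hV
  right_inv' A _ := Function.leftInverse_invFun (graphSub_injective g) A

/-- First block of the change of splitting, `A ↦ a + b A`. -/
def blockFst (g g' : ((Fin k → ℂ) × (Fin m → ℂ)) ≃ₗ[ℂ] E) (A : Model k m) :
    (Fin k → ℂ) →L[ℂ] (Fin k → ℂ) :=
  ((ContinuousLinearMap.fst ℂ _ _).comp
    ((g.trans g'.symm).toLinearMap.toContinuousLinearMap)).comp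
    ((ContinuousLinearMap.id ℂ _).prod A)

/-- Second block of the change of splitting, `A ↦ c + d A`. -/
def blockSnd (g g' : ((Fin k → ℂ) × (Fin m → ℂ)) ≃ₗ[ℂ] E) (A : Model k m) : Model k m :=
  ((ContinuousLinearMap.snd ℂ _ _).comp
    ((g.trans g'.symm).toLinearMap.toContinuousLinearMap)).comp
    ((ContinuousLinearMap.id ℂ _).prod A)

theorem blockFst_apply (g g' : ((Fin k → ℂ) × (Fin m → ℂ)) ≃ₗ[ℂ] E) (A : Model k m)
    (x : Fin k → ℂ) : blockFst g g' A x = (g'.symm (g (x, A x))).1 := rfl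

theorem blockSnd_apply (g g' : ((Fin k → ℂ) × (Fin m → ℂ)) ≃ₗ[ℂ] E) (A : Model k m)
    (x : Fin k → ℂ) : blockSnd g g' A x = (g'.symm (g (x, A x))).2 := rfl

theorem graphSub_eq_of_isUnit (g g' : ((Fin k → ℂ) × (Fin m → ℂ)) ≃ₗ[ℂ] E) (A : Model k m)
    (h : IsUnit (blockFst g g' A)) :
    graphSub g A = graphSub g' ((blockSnd g g' A).comp (Ring.inverse (blockFst g g' A))) := by
  obtain ⟨u, hu⟩ := h
  rw [← hu, Ring.inverse_unit]
  have hle : (graphSub g A).toSubmodule ≤ (graphSub g'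
      ((blockSnd g g' A).comp (↑u⁻¹ : (Fin k → ℂ) →L[ℂ] (Fin k → ℂ)))).toSubmodule := by
    rintro _ ⟨x, rfl⟩
    rw [mem_graphSub, graphMap_apply, ← blockFst_apply, ← blockSnd_apply, ← hu]
    have : (↑u⁻¹ : (Fin k → ℂ) →L[ℂ] (Fin k → ℂ)) ((u : (Fin k → ℂ) →L[ℂ] (Fin k → ℂ)) x) = x := by
      rw [← mul_apply_eq_comp, Units.inv_mul]; rfl
    rw [ContinuousLinearMap.comp_apply, this]
  have hfd : FiniteDimensional ℂ E := Module.Finite.equiv g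
  ext1
  exact Submodule.eq_of_le_of_finrank_eq hle (by rw [Grass.finrank_eq, Grass.finrank_eq])

theorem isUnit_of_graphSub_eq (g g' : ((Fin k → ℂ) × (Fin m → ℂ)) ≃ₗ[ℂ] E) (A B : Model k m)
    (h : graphSub g A = graphSub g' B) : IsUnit (blockFst g g' A) := by
  have hinj : Function.Injective (blockFst g g' A) := by
    rw [injective_iff_map_eq_zero]
    intro x hx
    have hm : g (x, A x) ∈ (graphSub g' B).toSubmodule := by rw [← h]; exact ⟨x, rfl⟩
    rw [mem_graphSub] at hm
    rw [blockFst_apply] at hx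
    rw [hx, map_zero] at hm
    have h0 : g'.symm (g (x, A x)) = 0 := Prod.ext hx hm
    have h1 : (x, A x) = (0 : (Fin k → ℂ) × (Fin m → ℂ)) := by simpa using h0
    exact (Prod.ext_iff.1 h1).1
  have hsurj : Function.Surjective (blockFst g g' A) :=
    (LinearMap.injective_iff_surjective (f := (blockFst g g' A).toLinearMap)).1 hinj
  let e : (Fin k → ℂ) ≃L[ℂ] (Fin k → ℂ) :=
    (LinearEquiv.ofBijective (blockFst g g' A).toLinearMap ⟨hinj, hsurj⟩).toContinuousLinearEquiv
  refine ⟨(ContinuousLinearEquiv.unitsEquiv ℂ (Fin k → ℂ)).symm e, ?_⟩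
  ext1 x; rfl

theorem trans_source (g g' : ((Fin k → ℂ) × (Fin m → ℂ)) ≃ₗ[ℂ] E) :
    ((graphChart g).symm.trans (graphChart g')).source = {A | IsUnit (blockFst g g' A)} := by
  ext A
  simp only [PartialEquiv.trans_source, PartialEquiv.symm_source, graphChart, mem_inter_iff,
    mem_univ, true_and, mem_preimage, PartialEquiv.coe_symm_mk, mem_range, mem_ofPred_eq]
  constructor
  · rintro ⟨B, hB⟩; exact isUnit_of_graphSub_eq g g' A B hB.symm
  · intro h; exact ⟨_, (graphSub_eq_of_isUnit g g' A h).symm⟩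

theorem trans_apply (g g' : ((Fin k → ℂ) × (Fin m → ℂ)) ≃ₗ[ℂ] E) (A : Model k m)
    (h : IsUnit (blockFst g g' A)) :
    (graphChart g).symm.trans (graphChart g') A =
      (blockSnd g g' A).comp (Ring.inverse (blockFst g g' A)) := by
  change Function.invFun (graphSub g') (graphSub g A) = _
  rw [graphSub_eq_of_isUnit g g' A h]
  exact Function.leftInverse_invFun (graphSub_injective g') _

theorem contDiff_blockFst (g g' : ((Fin k → ℂ) × (Fin m → ℂ)) ≃ₗ[ℂ] E) :
    ContDiff ℂ ω (blockFst g g') := by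
  have : blockFst g g' = fun A =>
      ((ContinuousLinearMap.fst ℂ _ _).comp
        ((g.trans g'.symm).toLinearMap.toContinuousLinearMap)).comp
        (ContinuousLinearMap.inl ℂ _ _ + (ContinuousLinearMap.inr ℂ _ _).comp A) := by
    funext A; ext1 x
    have hx : (x, A x) = (x, 0) + ((0 : Fin k → ℂ), A x) := by simp
    rw [blockFst_apply, hx, map_add, map_add]; simp
  rw [this]
  exact contDiff_const.clm_comp (contDiff_const.add (contDiff_const.clm_comp contDiff_id))

theorem contDiff_blockSnd (g g' : ((Fin k → ℂ) × (Fin m → ℂ)) ≃ₗ[ℂ] E) :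
    ContDiff ℂ ω (blockSnd g g') := by
  have : blockSnd g g' = fun A =>
      ((ContinuousLinearMap.snd ℂ _ _).comp
        ((g.trans g'.symm).toLinearMap.toContinuousLinearMap)).comp
        (ContinuousLinearMap.inl ℂ _ _ + (ContinuousLinearMap.inr ℂ _ _).comp A) := by
    funext A; ext1 x
    have hx : (x, A x) = (x, 0) + ((0 : Fin k → ℂ), A x) := by simp
    rw [blockSnd_apply, hx, map_add, map_add]; simp
  rw [this]
  exact contDiff_const.clm_comp (contDiff_const.add (contDiff_const.clm_comp contDiff_id))

theorem contDiffOn_trans (g g' : ((Fin k → ℂ) × (Fin m → ℂ)) ≃ₗ[ℂ] E) :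
    ContDiffOn ℂ ω ((graphChart g).symm.trans (graphChart g'))
      ((graphChart g).symm.trans (graphChart g')).source := by
  rw [trans_source]
  refine ContDiffOn.congr (f := fun A => (blockSnd g g' A).comp (Ring.inverse (blockFst g g' A)))
    ?_ (fun A hA => trans_apply g g' A hA)
  intro A hA
  obtain ⟨u, hu⟩ : IsUnit (blockFst g g' A) := hA
  have h1 : ContDiffAt ℂ ω (fun A => Ring.inverse (blockFst g g' A)) A := by
    refine ContDiffAt.comp (g := Ring.inverse) A ?_ (contDiff_blockFst g g').contDiffAt
    rw [← hu]
    exact contDiffAt_ringInverse ℂ u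
  exact ((contDiff_blockSnd g g').contDiffAt.clm_comp h1).contDiffWithinAt

theorem isOpen_trans_source (g g' : ((Fin k → ℂ) × (Fin m → ℂ)) ≃ₗ[ℂ] E) :
    IsOpen ((graphChart g).symm.trans (graphChart g')).source := by
  rw [trans_source]
  exact Units.isOpen.preimage (contDiff_blockFst g g').continuous

variable [FiniteDimensional ℂ E] [hE : Fact (finrank ℂ E = k + m)]

theorem exists_adapted (V : Grass k m E) :
    ∃ g : ((Fin k → ℂ) × (Fin m → ℂ)) ≃ₗ[ℂ] E, graphSub g 0 = V := by
  obtain ⟨W, hW⟩ := Submodule.exists_isCompl V.toSubmodule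
  have hWm : finrank ℂ W = m := by
    have := Submodule.finrank_add_eq_of_isCompl hW
    rw [V.finrank_eq, hE.out] at this
    omega
  let e₁ : (Fin k → ℂ) ≃ₗ[ℂ] V.toSubmodule :=
    LinearEquiv.ofFinrankEq _ _ (by simp [V.finrank_eq])
  let e₂ : (Fin m → ℂ) ≃ₗ[ℂ] W := LinearEquiv.ofFinrankEq _ _ (by simp [hWm])
  let g := (e₁.prodCongr e₂).trans (Submodule.prodEquivOfIsCompl _ _ hW)
  refine ⟨g, ?_⟩
  ext1
  refine Submodule.eq_of_le_of_finrank_eq ?_ (by rw [Grass.finrank_eq, Grass.finrank_eq])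
  rintro _ ⟨x, rfl⟩
  simp [g]

/-- A splitting `g : ℂᵏ × ℂᵐ ≃ E` with `g (ℂᵏ × 0) = V`. -/
def adapted (V : Grass k m E) : ((Fin k → ℂ) × (Fin m → ℂ)) ≃ₗ[ℂ] E :=
  (exists_adapted V).choose

variable (k m E) in
/-- The atlas of all affine charts of the Grassmannian. -/
def chartedCore : ChartedSpaceCore (Model k m) (Grass k m E) where
  atlas := range graphChart
  chartAt V := graphChart (adapted V)
  mem_chart_source V := ⟨0, (exists_adapted V).choose_spec⟩
  chart_mem_atlas _ := mem_range_self _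
  open_source := by
    rintro _ _ ⟨g, rfl⟩ ⟨g', rfl⟩; exact isOpen_trans_source g g'
  continuousOn_toFun := by
    rintro _ _ ⟨g, rfl⟩ ⟨g', rfl⟩; exact (contDiffOn_trans g g').continuousOn

instance : TopologicalSpace (Grass k m E) := (chartedCore k m E).toTopologicalSpace

instance : ChartedSpace (Model k m) (Grass k m E) := (chartedCore k m E).toChartedSpace

instance (n : WithTop ℕ∞) : IsManifold 𝓘(ℝ, Model k m) n (Grass k m E) := by
  refine isManifold_of_contDiffOn _ _ _ ?_
  intro e e' he he'
  obtain ⟨_, ⟨_, rfl⟩, ⟨_, ⟨⟨g, rfl⟩, rfl⟩, rfl⟩⟩ := he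
  obtain ⟨_, ⟨_, rfl⟩, ⟨_, ⟨⟨g', rfl⟩, rfl⟩, rfl⟩⟩ := he'
  have h := ((contDiffOn_trans g g').restrict_scalars ℝ).of_le (m := n) le_top
  refine h.mono ?_
  rintro A ⟨hA, -⟩
  exact hA

end Charts

/-! ### Lines in `ℂP³` -/

/-- `ℂ⁴` with its standard Hermitian structure; its projectivization is `ℂP³`. -/
abbrev C4 : Type := EuclideanSpace ℂ (Fin 4)

/-- The basis vector `e i`, representing the point `p i` of `ℂP³`. -/
abbrev e (i : Fin 4) : C4 := EuclideanSpace.single i 1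

instance : Fact (finrank ℂ C4 = 2 + 2) := ⟨by simp⟩

/-- `Gr(1,3)`: projective lines in `ℂP³`, i.e. `2`-dimensional subspaces of `ℂ⁴`. -/
abbrev Gr13 : Type := Grass 2 2 C4

/-- The `2`-dimensional subspace of `ℂ⁴` whose projectivization is the line `⟨p₂, p₃⟩`. -/
def W23 : Submodule ℂ C4 := Submodule.span ℂ {e 2, e 3}

instance : Fact (finrank ℂ W23 = 1 + 1) := ⟨by
  have hli : LinearIndependent ℂ ![e 2, e 3] := by
    rw [LinearIndependent.pair_iff]
    intro s t h
    have h2 := congrArg (fun v : C4 => v 2) h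
    have h3 := congrArg (fun v : C4 => v 3) h
    simp [e] at h2 h3
    exact ⟨h2, h3⟩
  have h := finrank_span_eq_card hli
  have hr : range ![e 2, e 3] = {e 2, e 3} := by
    rw [Matrix.range_cons, Matrix.range_cons, Matrix.range_empty, union_empty]; rfl
  rw [hr] at h
  exact h⟩

/-- The projective line `⟨p₂, p₃⟩`: the one-dimensional subspaces of `W23`. -/
abbrev P23 : Type := Grass 1 1 W23

/-- A point of `⟨p₂, p₃⟩` as a one-dimensional subspace of `ℂ⁴`. -/
def P23.line (s : P23) : Submodule ℂ C4 := s.toSubmodule.map W23.subtype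

/-- The function `μ̃ i (l) = max_{v ∈ V, v ≠ 0} |⟨e i, v⟩|² / |v|²` on `Gr(1,3)`. -/
def mu (i : Fin 4) (l : Gr13) : ℝ :=
  sSup {r : ℝ | ∃ v ∈ l.toSubmodule, v ≠ 0 ∧ r = ‖inner ℂ (e i) v‖ ^ 2 / ‖v‖ ^ 2}

/-- The subset `Gr⁰(1,3)`. -/
def Gr0 : Set Gr13 := {l | 0 < mu 0 l ∧ 0 < mu 1 l ∧ mu 0 l + mu 1 l < 1}

/-- The open triangle of admissible values of `(μ̃₀, μ̃₁)`. -/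
def Triangle : Set (ℝ × ℝ) := {c | 0 < c.1 ∧ 0 < c.2 ∧ c.1 + c.2 < 1}

/-! ### The torus action -/

/-- The torus `T² = U(1) × U(1)`. -/
abbrev T2 : Type := Circle × Circle

/-- The diagonal entries `(t₀, t₁, 1, 1)`. -/
def torusDiag (t : T2) : Fin 4 → ℂ := ![(t.1 : ℂ), (t.2 : ℂ), 1, 1]

theorem torusDiag_mul (s t : T2) : torusDiag (s * t) = torusDiag s * torusDiag t := by
  funext i; fin_cases i <;> simp [torusDiag]

/-- The linear action of `T²` on `ℂ⁴`: `(z₀, z₁, z₂, z₃) ↦ (t₀ z₀, t₁ z₁, z₂, z₃)`. -/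
def torusLin (t : T2) : C4 →ₗ[ℂ] C4 where
  toFun v := WithLp.toLp 2 fun i => torusDiag t i * v i
  map_add' v w := by ext i; simp [mul_add]
  map_smul' c v := by ext i; simp [mul_left_comm]

theorem torusLin_one : torusLin 1 = LinearMap.id := by
  ext1 v; ext i; fin_cases i <;> simp [torusLin, torusDiag]

theorem torusLin_mul (s t : T2) : torusLin (s * t) = torusLin s ∘ₗ torusLin t := by
  ext1 v; ext i; simp [torusLin, torusDiag_mul, mul_assoc]

theorem torusLin_injective (t : T2) : Function.Injective (torusLin t) := by
  have h : torusLin t⁻¹ ∘ₗ torusLin t = LinearMap.id := by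
    rw [← torusLin_mul, inv_mul_cancel, torusLin_one]
  exact Function.LeftInverse.injective (g := torusLin t⁻¹) fun v => LinearMap.congr_fun h v

/-- The induced action of `T²` on the set of lines. -/
instance : MulAction T2 Gr13 where
  smul t l :=
    { toSubmodule := l.toSubmodule.map (torusLin t)
      finrank_eq := by
        rw [← (Submodule.equivMapOfInjective _ (torusLin_injective t) l.toSubmodule).finrank_eq,
          l.finrank_eq] }
  one_smul l := by
    ext1
    change l.toSubmodule.map (torusLin 1) = _
    rw [torusLin_one, Submodule.map_id]
  mul_smul s t l := by
    ext1
    change l.toSubmodule.map (torusLin (s * t)) =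
      (l.toSubmodule.map (torusLin t)).map (torusLin s)
    rw [torusLin_mul, Submodule.map_comp]

/-- The two coordinate circles `θ ↦ (exp (iθ), 1)` and `θ ↦ (1, exp (iθ))` of `T²`. -/
def oneParam (i : Fin 2) (θ : ℝ) : T2 :=
  if i = 0 then (Circle.exp θ, 1) else (1, Circle.exp θ)

/-! ### The Kähler form of the Plücker embedding -/

/-- `Λ²ℂ⁴` with its Plücker coordinates `w i j`, `i < j`, and the induced Hermitian structure. -/
abbrev Lambda2 : Type := EuclideanSpace ℂ {p : Fin 4 × Fin 4 // p.1 < p.2}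

/-- The bivector `u ∧ v`, with coordinates `w i j = u i * v j - u j * v i`. -/
def wedge (u v : C4) : Lambda2 :=
  WithLp.toLp 2 fun p => u p.1.1 * v p.1.2 - u p.1.2 * v p.1.1

/-- The pull-back to `Λ²ℂ⁴ \ {0}` of the Fubini–Study form of `ℙ(Λ²ℂ⁴)`, evaluated at the point `w`
on the vectors `x, y`; the normalization is `i ∂∂̄ log |w|²`. -/
def fubiniStudy (w x y : Lambda2) : ℝ :=
  2 * (inner ℂ x y * (‖w‖ : ℂ) ^ 2 - inner ℂ x w * inner ℂ w y).im / ‖w‖ ^ 4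

/-- A local lift to `Λ²ℂ⁴ \ {0}`, near `l`, of the Plücker embedding `Gr(1,3) → ℙ(Λ²ℂ⁴)`: in the
chart of a splitting `g` at `l`, the graph of `A` is sent to `g (ε₀, A ε₀) ∧ g (ε₁, A ε₁)`. -/
def plueckerLift (l l' : Gr13) : Lambda2 :=
  let A : Model 2 2 := chartAt (Model 2 2) l l'
  wedge (graphMap (adapted l) A (Pi.single 0 1)) (graphMap (adapted l) A (Pi.single 1 1))

/-- The standard Kähler form of `Gr(1,3)`: the pull-back of the Fubini–Study form by the Plücker
embedding. It does not depend on the local lift that is used to compute it. -/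
def kaehler (l : Gr13) (X Y : TangentSpace 𝓘(ℝ, Model 2 2) l) : ℝ :=
  fubiniStudy (plueckerLift l l)
    (mfderiv 𝓘(ℝ, Model 2 2) 𝓘(ℝ, Lambda2) (plueckerLift l) l X)
    (mfderiv 𝓘(ℝ, Model 2 2) 𝓘(ℝ, Lambda2) (plueckerLift l) l Y)

/-- `X` is a Hamiltonian vector field of `f` for the Kähler form, with the sign convention
`df (Y) = ω (Y, X)`. -/
def IsHamiltonianField (f : Gr13 → ℝ) (X : ∀ l : Gr13, TangentSpace 𝓘(ℝ, Model 2 2) l) : Prop :=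
  ∀ l : Gr13, MDifferentiableAt 𝓘(ℝ, Model 2 2) 𝓘(ℝ, ℝ) f l ∧
    ∀ Y : TangentSpace 𝓘(ℝ, Model 2 2) l,
      (mfderiv 𝓘(ℝ, Model 2 2) 𝓘(ℝ, ℝ) f l Y : ℝ) = kaehler l Y (X l)

end LineGrass

end

open LineGrass

open scoped Topology ComplexConjugate

noncomputable section

namespace LineGrass

/-! ### Affine charts of the Grassmannian and lines given by frames. -/

section GrassCharts

variable {k m : ℕ} {E : Type*} [AddCommGroup E] [Module ℂ E]

/-! The Hamiltonian statement is read off in Plücker coordinates. Representing the `i`-th coordinate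
function on `V` by a vector of `V` turns the maximum defining `mu i` into `pluckerMu i`, the
Rayleigh quotient of the diagonal 0-1 operator that keeps the coordinates whose index pair contains
`i` (`mu_eq_pluckerMu`). The `i`-th circle acts on `Λ²ℂ⁴` by the exponential of `iθ` times this same
operator, and for the Fubini–Study form such a Rayleigh quotient generates such a flow
(`fubiniStudy_generator`, `isHamiltonianField_generator`).

For the fibration, `1 - mu 0 - mu 1` has the sign of `|w₂₃|² - |w₀₁|²`, so a line of `Gr0` has `w₂₃
≠ 0` and is the graph of a 2×2 matrix over the `(z₂, z₃)`-plane (`Gr0_subset_range`). With rows `a`,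
`b` and `S = 1 + |a|² + |b|² + |det|²`, the values are `(|a|² + |det|²)/S` and `(|b|² + |det|²)/S`,
and `Gr0` is given by `a ≠ 0`, `b ≠ 0`, `|det| < 1` (`mu_graphSub`, `graphSub_mem_Gr0`). The torus
multiplies the rows by phases, and `s₀`, `s₁` are the kernels of `b`, `a` (`line_eq_inf`), hence
invariant.

Over a fixed base point the rows are complex multiples of two fixed unit vectors. If `p`, `q` are
the squared moduli of the two coefficients, then `|det|² = k p q` with `k ≥ 0` depending only on the
base point. For every such `k` the map `(p, q) ↦ (mu 0, mu 1)` is a bijection from `p, q > 0`, `k p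
q < 1` onto the triangle, with an explicit smooth inverse (`fibreSol_spec`, `fibreSol_unique`,
`contDiffAt_fibreSol`). The phases of the coefficients supply the `T²` factor. Local smooth choices
of the unit vectors then trivialize the fibration (`exists_trivialization`), and the joint level
sets are slices of a trivialization (`exists_torus`). -/

@[simp] theorem graphChart_graphSub (g : ((Fin k → ℂ) × (Fin m → ℂ)) ≃ₗ[ℂ] E) (A : Model k m) :
    graphChart g (graphSub g A) = A :=
  Function.leftInverse_invFun (graphSub_injective g) A

theorem graphSub_graphChart (g : ((Fin k → ℂ) × (Fin m → ℂ)) ≃ₗ[ℂ] E) {V : Grass k m E}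
    (hV : V ∈ range (graphSub g)) : graphSub g (graphChart g V) = V :=
  Function.invFun_eq hV

/-- If the image under `g₀` of the range of `(P, Q)` is the image under `g` of a graph, then the
first component of `g⁻¹ g₀ (P, Q)` is invertible. -/
theorem isUnit_of_frame (g₀ g : ((Fin k → ℂ) × (Fin m → ℂ)) ≃ₗ[ℂ] E)
    (P : (Fin k → ℂ) →L[ℂ] (Fin k → ℂ)) (Q : Model k m) (A : Model k m)
    (h : (graphSub g A).toSubmodule = LinearMap.range (g₀.toLinearMap ∘ₗ (P.prod Q).toLinearMap)) :
    IsUnit ((ContinuousLinearMap.fst ℂ _ _).comp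
      (((g₀.trans g.symm).toLinearMap.toContinuousLinearMap).comp (P.prod Q))) := by
  set R := (ContinuousLinearMap.fst ℂ _ _).comp
      (((g₀.trans g.symm).toLinearMap.toContinuousLinearMap).comp (P.prod Q)) with hR
  have hsurj : Function.Surjective R := by
    intro u
    have : g (u, A u) ∈ (graphSub g A).toSubmodule := ⟨u, rfl⟩
    rw [h] at this
    obtain ⟨z, hz⟩ := this
    refine ⟨z, ?_⟩
    have h2 : g.symm (g₀ (P z, Q z)) = (u, A u) := by
      rw [← g.symm_apply_apply (u, A u), ← hz]; rfl
    exact congrArg Prod.fst h2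
  have hinj : Function.Injective R :=
    (LinearMap.injective_iff_surjective (f := R.toLinearMap)).2 hsurj
  let e : (Fin k → ℂ) ≃L[ℂ] (Fin k → ℂ) :=
    (LinearEquiv.ofBijective R.toLinearMap ⟨hinj, hsurj⟩).toContinuousLinearEquiv
  refine ⟨(ContinuousLinearEquiv.unitsEquiv ℂ (Fin k → ℂ)).symm e, ?_⟩
  ext1 x; rfl

/-- Precomposing a frame with the inverse of its first component makes that component the identity,
so the frame becomes a graph; the dimension count upgrades inclusion to equality. -/
theorem eq_graphSub_of_frame (g₀ g : ((Fin k → ℂ) × (Fin m → ℂ)) ≃ₗ[ℂ] E)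
    (P : (Fin k → ℂ) →L[ℂ] (Fin k → ℂ)) (Q : Model k m) (V : Grass k m E)
    (h : V.toSubmodule = LinearMap.range (g₀.toLinearMap ∘ₗ (P.prod Q).toLinearMap))
    (hu : IsUnit ((ContinuousLinearMap.fst ℂ _ _).comp
      (((g₀.trans g.symm).toLinearMap.toContinuousLinearMap).comp (P.prod Q)))) :
    V = graphSub g (((ContinuousLinearMap.snd ℂ _ _).comp
      (((g₀.trans g.symm).toLinearMap.toContinuousLinearMap).comp (P.prod Q))).comp
      (Ring.inverse ((ContinuousLinearMap.fst ℂ _ _).comp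
      (((g₀.trans g.symm).toLinearMap.toContinuousLinearMap).comp (P.prod Q))))) := by
  have hfd : FiniteDimensional ℂ E := Module.Finite.equiv g
  obtain ⟨u, hu⟩ := hu
  rw [← hu, Ring.inverse_unit]
  ext1
  refine Submodule.eq_of_le_of_finrank_eq ?_ (by rw [Grass.finrank_eq, Grass.finrank_eq])
  rw [h]
  rintro _ ⟨z, rfl⟩
  rw [mem_graphSub]
  have h1 : (g.symm ((g₀.toLinearMap ∘ₗ (P.prod Q).toLinearMap) z)).1 =
      (u : (Fin k → ℂ) →L[ℂ] (Fin k → ℂ)) z := by rw [hu]; rfl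
  have h2 : (↑u⁻¹ : (Fin k → ℂ) →L[ℂ] (Fin k → ℂ)) ((u : (Fin k → ℂ) →L[ℂ] (Fin k → ℂ)) z) = z := by
    rw [← mul_apply_eq_comp, Units.inv_mul]; rfl
  rw [h1, ContinuousLinearMap.comp_apply, h2]
  rfl

variable [FiniteDimensional ℂ E] [hE : Fact (finrank ℂ E = k + m)]

/-- The affine chart of a splitting as an open partial homeomorphism. -/
def affineChart (g : ((Fin k → ℂ) × (Fin m → ℂ)) ≃ₗ[ℂ] E) :
    OpenPartialHomeomorph (Grass k m E) (Model k m) :=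
  (chartedCore k m E).openPartialHomeomorph (graphChart g) (mem_range_self g)

theorem affineChart_mem_atlas (g : ((Fin k → ℂ) × (Fin m → ℂ)) ≃ₗ[ℂ] E) :
    affineChart g ∈ atlas (Model k m) (Grass k m E) := by
  refine mem_iUnion₂.2 ⟨graphChart g, mem_range_self g, rfl⟩

theorem isOpen_range_graphSub (g : ((Fin k → ℂ) × (Fin m → ℂ)) ≃ₗ[ℂ] E) :
    IsOpen (range (graphSub g : Model k m → Grass k m E)) :=
  (affineChart g).open_source

theorem contMDiffOn_graphChart {n : WithTop ℕ∞} (g : ((Fin k → ℂ) × (Fin m → ℂ)) ≃ₗ[ℂ] E) :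
    ContMDiffOn 𝓘(ℝ, Model k m) 𝓘(ℝ, Model k m) n (graphChart g) (range (graphSub g)) :=
  contMDiffOn_of_mem_maximalAtlas (e := affineChart g)
    (IsManifold.subset_maximalAtlas (affineChart_mem_atlas g))

theorem contMDiff_graphSub {n : WithTop ℕ∞} (g : ((Fin k → ℂ) × (Fin m → ℂ)) ≃ₗ[ℂ] E) :
    ContMDiff 𝓘(ℝ, Model k m) 𝓘(ℝ, Model k m) n (graphSub g : Model k m → Grass k m E) :=
  contMDiffOn_univ.1 (contMDiffOn_symm_of_mem_maximalAtlas (e := affineChart g)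
    (IsManifold.subset_maximalAtlas (affineChart_mem_atlas g)))

theorem mem_range_adapted (V : Grass k m E) : V ∈ range (graphSub (adapted V)) :=
  ⟨0, (exists_adapted V).choose_spec⟩

theorem graphSub_adapted (V : Grass k m E) : graphSub (adapted V) 0 = V :=
  (exists_adapted V).choose_spec

/-! ### Smoothness criteria for maps into and out of the Grassmannian. -/

section Smooth

variable {F : Type*} [NormedAddCommGroup F] [NormedSpace ℝ F] {H : Type*} [TopologicalSpace H]
  {I : ModelWithCorners ℝ F H} {M : Type*} [TopologicalSpace M] [ChartedSpace H M]
  {n : WithTop ℕ∞}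

/-- A map to the Grassmannian that has a smooth local frame is smooth. -/
theorem contMDiffAt_of_frame (g₀ : ((Fin k → ℂ) × (Fin m → ℂ)) ≃ₗ[ℂ] E)
    {P : M → (Fin k → ℂ) →L[ℂ] (Fin k → ℂ)} {Q : M → Model k m} {f : M → Grass k m E} {x : M}
    (hP : ContMDiffAt I 𝓘(ℝ, (Fin k → ℂ) →L[ℂ] (Fin k → ℂ)) n P x)
    (hQ : ContMDiffAt I 𝓘(ℝ, Model k m) n Q x)
    (h : ∀ᶠ y in 𝓝 x, (f y).toSubmodule =
      LinearMap.range (g₀.toLinearMap ∘ₗ ((P y).prod (Q y)).toLinearMap)) :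
    ContMDiffAt I 𝓘(ℝ, Model k m) n f x := by
  set g := adapted (f x)
  let T := (g₀.trans g.symm).toLinearMap.toContinuousLinearMap
  let R : M → (Fin k → ℂ) →L[ℂ] (Fin k → ℂ) := fun y =>
    (ContinuousLinearMap.fst ℂ _ _).comp (T.comp ((P y).prod (Q y)))
  let S : M → Model k m := fun y =>
    (ContinuousLinearMap.snd ℂ _ _).comp (T.comp ((P y).prod (Q y)))
  let L₁ : (((Fin k → ℂ) →L[ℂ] (Fin k → ℂ)) × Model k m) → (Fin k → ℂ) →L[ℂ] (Fin k → ℂ) :=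
    fun p => (ContinuousLinearMap.fst ℂ _ _).comp (T.comp (p.1.prod p.2))
  let L₂ : (((Fin k → ℂ) →L[ℂ] (Fin k → ℂ)) × Model k m) → Model k m :=
    fun p => (ContinuousLinearMap.snd ℂ _ _).comp (T.comp (p.1.prod p.2))
  have hprod : ContDiff ℂ ω (fun p : ((Fin k → ℂ) →L[ℂ] (Fin k → ℂ)) × Model k m =>
      p.1.prod p.2) := by
    have : (fun p : ((Fin k → ℂ) →L[ℂ] (Fin k → ℂ)) × Model k m => p.1.prod p.2) = fun p =>
        (ContinuousLinearMap.inl ℂ _ _).comp p.1 + (ContinuousLinearMap.inr ℂ _ _).comp p.2 := by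
      funext p; ext1 x; simp
    rw [this]
    exact (contDiff_const.clm_comp contDiff_fst).add (contDiff_const.clm_comp contDiff_snd)
  have hL₁ : ContDiff ℂ ω L₁ := contDiff_const.clm_comp (contDiff_const.clm_comp hprod)
  have hL₂ : ContDiff ℂ ω L₂ := contDiff_const.clm_comp (contDiff_const.clm_comp hprod)
  have hx := h.self_of_nhds
  -- In the chart adapted to `f x` that point is the graph of `0`, which forces invertibility at
  -- `x`; near `x` it persists because units form an open set.
  have hux : IsUnit (L₁ (P x, Q x)) := by
    refine isUnit_of_frame g₀ g (P x) (Q x) 0 ?_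
    rw [graphSub_adapted]; exact hx
  have hsm : ContDiffAt ℂ ω (fun p => (L₂ p).comp (Ring.inverse (L₁ p))) (P x, Q x) := by
    obtain ⟨u, hu⟩ := hux
    have h1 : ContDiffAt ℂ ω (fun p => Ring.inverse (L₁ p)) (P x, Q x) := by
      refine ContDiffAt.comp (g := Ring.inverse) _ ?_ hL₁.contDiffAt
      rw [← hu]
      exact contDiffAt_ringInverse ℂ u
    exact hL₂.contDiffAt.clm_comp h1
  have hsm' := ((hsm.restrict_scalars ℝ).of_le (m := n) le_top).contMDiffAt
  have hPQ : ContMDiffAt I 𝓘(ℝ, ((Fin k → ℂ) →L[ℂ] (Fin k → ℂ)) × Model k m) n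
    (fun y => (P y, Q y)) x := hP.prodMk_space hQ
  have hcomp := (contMDiff_graphSub (n := n) g).contMDiffAt.comp x
    (ContMDiffAt.comp x hsm' hPQ)
  refine hcomp.congr_of_eventuallyEq ?_
  have hev : ∀ᶠ y in 𝓝 x, IsUnit (L₁ (P y, Q y)) :=
    (hL₁.continuous.continuousAt.comp hPQ.continuousAt).eventually
      (Units.isOpen.mem_nhds hux)
  filter_upwards [h, hev] with y hy hyu
  exact eq_graphSub_of_frame g₀ g (P y) (Q y) (f y) hy hyu

theorem contMDiffAt_of_comp_graphSub (g : ((Fin k → ℂ) × (Fin m → ℂ)) ≃ₗ[ℂ] E)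
    {f : Grass k m E → M} {A : Model k m}
    (h : ContMDiffAt 𝓘(ℝ, Model k m) I n (fun B => f (graphSub g B)) A) :
    ContMDiffAt 𝓘(ℝ, Model k m) I n f (graphSub g A) := by
  have h1 : ContMDiffAt 𝓘(ℝ, Model k m) 𝓘(ℝ, Model k m) n (graphChart g) (graphSub g A) :=
    (contMDiffOn_graphChart g).contMDiffAt
      ((isOpen_range_graphSub g).mem_nhds (mem_range_self A))
  rw [← graphChart_graphSub g A] at h
  refine (h.comp (graphSub g A) h1).congr_of_eventuallyEq ?_
  filter_upwards [(isOpen_range_graphSub g).mem_nhds (mem_range_self A)] with V hV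
  simp only [Function.comp_apply, graphSub_graphChart g hV]

end Smooth

end GrassCharts

/-! ### The functions `μ̃ i` in Plücker coordinates -/

theorem sum_pairs {α : Type*} [AddCommMonoid α] (f : {p : Fin 4 × Fin 4 // p.1 < p.2} → α) :
    ∑ p, f p = f ⟨(0, 1), by decide⟩ + f ⟨(0, 2), by decide⟩ + f ⟨(0, 3), by decide⟩ +
      f ⟨(1, 2), by decide⟩ + f ⟨(1, 3), by decide⟩ + f ⟨(2, 3), by decide⟩ := by
  have : (Finset.univ : Finset {p : Fin 4 × Fin 4 // p.1 < p.2}) =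
      {⟨(0, 1), by decide⟩, ⟨(0, 2), by decide⟩, ⟨(0, 3), by decide⟩, ⟨(1, 2), by decide⟩,
        ⟨(1, 3), by decide⟩, ⟨(2, 3), by decide⟩} := by decide
  rw [this]
  repeat rw [Finset.sum_insert (by decide)]
  rw [Finset.sum_singleton]
  simp only [add_assoc]

/-- Lagrange's identity: the right side is the Gram determinant of `u`, `v`. -/
theorem wedge_norm_sq (u v : C4) :
    ((‖wedge u v‖ : ℂ) ^ 2) = inner ℂ u u * inner ℂ v v - inner ℂ u v * inner ℂ v u := by
  have h : ((‖wedge u v‖ : ℂ) ^ 2) = inner ℂ (wedge u v) (wedge u v) := by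
    rw [inner_self_eq_norm_sq_to_K]; rfl
  rw [h]
  simp only [PiLp.inner_apply, Fin.sum_univ_four, sum_pairs, wedge, RCLike.inner_apply, map_sub,
    map_mul]
  ring

/-- The contraction of `u ∧ v` with the `i`-th coordinate function. -/
def contraction (i : Fin 4) (u v : C4) : C4 := u i • v - v i • u

/-- The indicator function of the Plücker coordinates that involve the index `i`. -/
def involves (i : Fin 4) (p : {p : Fin 4 × Fin 4 // p.1 < p.2}) : ℝ :=
  if p.1.1 = i ∨ p.1.2 = i then 1 else 0

/-- Up to sign the `j`-th entry of the contraction is the Plücker coordinate of the pair `{i, j}`,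
and the `i`-th entry vanishes. -/
theorem contraction_norm_sq (i : Fin 4) (u v : C4) :
    ‖contraction i u v‖ ^ 2 = ∑ p, involves i p * ‖wedge u v p‖ ^ 2 := by
  rw [EuclideanSpace.norm_sq_eq, sum_pairs, Fin.sum_univ_four]
  -- Only pairs in increasing order are stored, so entries with `j < i` occur with the opposite
  -- sign.
  have hs : ∀ a b c d : ℂ, ‖a * b - c * d‖ = ‖c * d - a * b‖ := fun a b c d => norm_sub_rev _ _
  fin_cases i
  · simp [contraction, wedge, involves]
    simp only [mul_comm (v _) (u _), sub_self, norm_zero]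
    ring
  · simp [contraction, wedge, involves]
    rw [hs (u 1) (v 0)]
    simp only [mul_comm (v _) (u _), sub_self, norm_zero]
    ring
  · simp [contraction, wedge, involves]
    rw [hs (u 2) (v 0), hs (u 2) (v 1)]
    simp only [mul_comm (v _) (u _), sub_self, norm_zero]
    ring
  · simp [contraction, wedge, involves]
    rw [hs (u 3) (v 0), hs (u 3) (v 1), hs (u 3) (v 2)]
    simp only [mul_comm (v _) (u _), sub_self, norm_zero]
    ring

theorem span_eq_of_wedge_ne_zero {l : Gr13} {u v : C4} (hu : u ∈ l.toSubmodule)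
    (hv : v ∈ l.toSubmodule) (hw : wedge u v ≠ 0) :
    l.toSubmodule = Submodule.span ℂ {u, v} := by
  have hli : LinearIndependent ℂ ![u, v] := by
    rw [LinearIndependent.pair_iff]
    intro s t h
    have hc : ∀ i, s * u i + t * v i = 0 := fun i => by
      simpa using congrArg (fun z : C4 => z i) h
    by_contra hst
    apply hw
    ext p
    simp only [wedge, PiLp.zero_apply]
    -- Wedging the relation `s u + t v = 0` with `v`, and then with `u`, gives `s (u ∧ v) = 0` and
    -- `t (u ∧ v) = 0`.
    have h1 : s * (u p.1.1 * v p.1.2 - u p.1.2 * v p.1.1) = 0 := by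
      linear_combination v p.1.2 * hc p.1.1 - v p.1.1 * hc p.1.2
    have h2 : t * (u p.1.1 * v p.1.2 - u p.1.2 * v p.1.1) = 0 := by
      linear_combination u p.1.1 * hc p.1.2 - u p.1.2 * hc p.1.1
    by_cases hs : s = 0
    · have ht : t ≠ 0 := fun ht => hst ⟨hs, ht⟩
      exact (mul_eq_zero.1 h2).resolve_left ht
    · exact (mul_eq_zero.1 h1).resolve_left hs
  symm
  refine Submodule.eq_of_le_of_finrank_eq ?_ ?_
  · rw [Submodule.span_le]
    rintro z (rfl | rfl) <;> assumption
  · have h := finrank_span_eq_card hli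
    have hr : range ![u, v] = {u, v} := by
      rw [Matrix.range_cons, Matrix.range_cons, Matrix.range_empty, union_empty]; rfl
    rw [hr] at h
    rw [h, l.finrank_eq]; rfl

/-- If `x ∈ V` represents the `i`-th coordinate function on `V`, then `μ̃ i (V) = ‖x‖²`. -/
theorem mu_eq_norm_sq {l : Gr13} {i : Fin 4} {x : C4} (hx : x ∈ l.toSubmodule)
    (h : ∀ z ∈ l.toSubmodule, inner ℂ x z = z i) : mu i l = ‖x‖ ^ 2 := by
  have he : ∀ z : C4, inner ℂ (e i) z = z i := fun z => by
    simp [e, EuclideanSpace.inner_single_left]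
  have hle : ∀ r ∈ {r : ℝ | ∃ v ∈ l.toSubmodule, v ≠ 0 ∧ r = ‖inner ℂ (e i) v‖ ^ 2 / ‖v‖ ^ 2},
      r ≤ ‖x‖ ^ 2 := by
    rintro r ⟨v, hv, hv0, rfl⟩
    rw [he, ← h v hv, div_le_iff₀ (by positivity), ← mul_pow]
    exact pow_le_pow_left₀ (norm_nonneg _) (norm_inner_le_norm x v) 2
  -- If `x = 0` the coordinate vanishes on `V` and any nonzero vector attains the maximum; otherwise
  -- `x` itself is the equality case of Cauchy–Schwarz.
  by_cases hx0 : x = 0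
  · obtain ⟨v, hv, hv0⟩ : ∃ v ∈ l.toSubmodule, v ≠ 0 := by
      refine Submodule.exists_mem_ne_zero_of_ne_bot fun hb => ?_
      have := l.finrank_eq
      rw [hb, finrank_bot] at this
      omega
    refine IsGreatest.csSup_eq ⟨⟨v, hv, hv0, ?_⟩, hle⟩
    rw [he, ← h v hv, hx0]; simp
  · refine IsGreatest.csSup_eq ⟨⟨x, hx, hx0, ?_⟩, hle⟩
    rw [he, ← h x hx, inner_self_eq_norm_sq_to_K]
    have : ‖x‖ ≠ 0 := norm_ne_zero_iff.2 hx0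
    simp
    field_simp

theorem mu_eq_contraction {l : Gr13} (i : Fin 4) {u v : C4} (hu : u ∈ l.toSubmodule)
    (hv : v ∈ l.toSubmodule) (hw : wedge u v ≠ 0) :
    mu i l = ‖contraction i u v‖ ^ 2 / ‖wedge u v‖ ^ 2 := by
  have hL := wedge_norm_sq u v
  set W : ℂ := (‖wedge u v‖ : ℂ) ^ 2 with hW
  have hW0 : W ≠ 0 := by
    rw [hW]; exact pow_ne_zero 2 (Complex.ofReal_ne_zero.2 (norm_ne_zero_iff.2 hw))
  have hWc : conj W = W := by rw [hW]; simp
  set y := contraction i u v with hy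
  have hyu : inner ℂ u y = u i * inner ℂ u v - v i * inner ℂ u u := by
    rw [hy, contraction, inner_sub_right, inner_smul_right, inner_smul_right]
  have hyv : inner ℂ v y = u i * inner ℂ v v - v i * inner ℂ v u := by
    rw [hy, contraction, inner_sub_right, inner_smul_right, inner_smul_right]
  -- Cramer's rule for the Gram matrix of `u`, `v`, whose determinant is `W`: this is the vector of
  -- `V` representing the `i`-th coordinate.
  let x : C4 := W⁻¹ • (inner ℂ y v • u - inner ℂ y u • v)
  have hx : x ∈ l.toSubmodule :=
    Submodule.smul_mem _ _ (Submodule.sub_mem _ (Submodule.smul_mem _ _ hu)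
      (Submodule.smul_mem _ _ hv))
  have hxz : ∀ z, inner ℂ x z = W⁻¹ * (inner ℂ v y * inner ℂ u z - inner ℂ u y * inner ℂ v z) := by
    intro z
    simp only [x, inner_smul_left, inner_sub_left, map_inv₀, hWc, inner_conj_symm]
  have key : ∀ z ∈ l.toSubmodule, inner ℂ x z = z i := by
    intro z hz
    rw [span_eq_of_wedge_ne_zero hu hv hw, Submodule.mem_span_pair] at hz
    obtain ⟨a, b, rfl⟩ := hz
    rw [hxz, inv_mul_eq_iff_eq_mul₀ hW0, hyu, hyv, hL]
    simp only [inner_add_right, inner_smul_right, PiLp.add_apply, PiLp.smul_apply, smul_eq_mul]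
    ring
  rw [mu_eq_norm_sq hx key]
  have h1 : ((‖x‖ : ℂ)) ^ 2 = (‖y‖ : ℂ) ^ 2 / W := by
    have e1 : ((‖x‖ : ℂ)) ^ 2 = inner ℂ x x := by rw [inner_self_eq_norm_sq_to_K]; rfl
    have e2 : ((‖y‖ : ℂ)) ^ 2 = inner ℂ y y := by rw [inner_self_eq_norm_sq_to_K]; rfl
    -- As `x` lies in `V`, its squared norm is its own `i`-th coordinate.
    rw [e1, e2, key x hx]
    have : inner ℂ y y = u i * inner ℂ y v - v i * inner ℂ y u := by
      conv_lhs =>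
        arg 3
        rw [hy, contraction]
      rw [inner_sub_right, inner_smul_right, inner_smul_right]
    rw [this]
    simp only [x, PiLp.smul_apply, PiLp.sub_apply, smul_eq_mul]
    field_simp
  rw [hW] at h1
  exact_mod_cast h1

theorem mu_eq_wedge {l : Gr13} (i : Fin 4) {u v : C4} (hu : u ∈ l.toSubmodule)
    (hv : v ∈ l.toSubmodule) (hw : wedge u v ≠ 0) :
    mu i l = (∑ p, involves i p * ‖wedge u v p‖ ^ 2) / ‖wedge u v‖ ^ 2 := by
  rw [mu_eq_contraction i hu hv hw, contraction_norm_sq]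

/-! ### Smoothness of the torus action -/

/-- The splitting `(x, y) ↦ (y₀, y₁, x₀, x₁)` of `ℂ⁴`. -/
def stdSplit : ((Fin 2 → ℂ) × (Fin 2 → ℂ)) ≃ₗ[ℂ] C4 where
  toFun p := WithLp.toLp 2 ![p.2 0, p.2 1, p.1 0, p.1 1]
  map_add' p q := by ext i; fin_cases i <;> simp
  map_smul' c p := by ext i; fin_cases i <;> simp
  invFun v := (![v 2, v 3], ![v 0, v 1])
  left_inv p := by
    ext i <;> fin_cases i <;> simp
  right_inv v := by ext i; fin_cases i <;> simp

theorem contMDiff_circle_coe {n : WithTop ℕ∞} :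
    ContMDiff (𝓡 1) 𝓘(ℝ, ℂ) n (fun z : Circle => (z : ℂ)) := by
  have : Fact (finrank ℝ ℂ = 1 + 1) := Complex.finrank_real_complex_fact
  exact contMDiff_coe_sphere (E := ℂ) (n := 1)

/-- The coordinate projection of `ℂ⁴` onto the line of `e j`. -/
def coordProj (j : Fin 4) : C4 →ₗ[ℂ] C4 where
  toFun v := EuclideanSpace.single j (v j)
  map_add' v w := by ext i; by_cases h : i = j <;> simp [h]
  map_smul' c v := by ext i; by_cases h : i = j <;> simp [h]

/-- Makes the dependence on `t` affine in two complex numbers, so smoothness in `t` reduces to that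
of the inclusion of the circle in `ℂ`. -/
theorem torusLin_eq (t : T2) : torusLin t =
    (t.1 : ℂ) • coordProj 0 + (t.2 : ℂ) • coordProj 1 + (coordProj 2 + coordProj 3) := by
  ext1 v
  ext i
  fin_cases i <;> simp [torusLin, torusDiag, coordProj]

/-- Near `l₀` lines are graphs of matrices `A`. Applying the torus to the graph frame gives a frame
polynomial in `(t, A)`, and `contMDiffAt_of_frame` applies. -/
theorem contMDiff_torus_smul {n : WithTop ℕ∞} :
    ContMDiff (((𝓡 1).prod (𝓡 1)).prod 𝓘(ℝ, Model 2 2)) 𝓘(ℝ, Model 2 2) n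
      (fun q : T2 × Gr13 => q.1 • q.2) := by
  rintro ⟨t₀, l₀⟩
  set g := adapted l₀
  let C : Fin 4 → ((Fin 2 → ℂ) × (Fin 2 → ℂ)) →L[ℂ] ((Fin 2 → ℂ) × (Fin 2 → ℂ)) := fun j =>
    (stdSplit.symm.toLinearMap ∘ₗ coordProj j ∘ₗ g.toLinearMap).toContinuousLinearMap
  -- The moved frame in the coordinates of `stdSplit`, extended from the torus to all pairs of
  -- complex numbers.
  let N : (ℂ × ℂ) × Model 2 2 → (Fin 2 → ℂ) →L[ℂ] ((Fin 2 → ℂ) × (Fin 2 → ℂ)) := fun p =>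
    (p.1.1 • C 0 + p.1.2 • C 1 + (C 2 + C 3)).comp
      (ContinuousLinearMap.inl ℂ _ _ + (ContinuousLinearMap.inr ℂ _ _).comp p.2)
  have hN : ContDiff ℂ ω N := by
    have h1 : ContDiff ℂ ω (fun p : (ℂ × ℂ) × Model 2 2 => p.1.1) := contDiff_fst.fst
    have h2 : ContDiff ℂ ω (fun p : (ℂ × ℂ) × Model 2 2 => p.1.2) := contDiff_fst.snd
    exact (((h1.smul contDiff_const).add (h2.smul contDiff_const)).add contDiff_const).clm_comp
      (contDiff_const.add (contDiff_const.clm_comp contDiff_snd))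
  have hP : ContDiff ℂ ω (fun p => (ContinuousLinearMap.fst ℂ (Fin 2 → ℂ) (Fin 2 → ℂ)).comp
      (N p)) := contDiff_const.clm_comp hN
  have hQ : ContDiff ℂ ω (fun p => (ContinuousLinearMap.snd ℂ (Fin 2 → ℂ) (Fin 2 → ℂ)).comp
      (N p)) := contDiff_const.clm_comp hN
  have hmap : ContMDiffAt (((𝓡 1).prod (𝓡 1)).prod 𝓘(ℝ, Model 2 2)) 𝓘(ℝ, (ℂ × ℂ) × Model 2 2) n
      (fun q : T2 × Gr13 => (((q.1.1 : ℂ), (q.1.2 : ℂ)), graphChart g q.2)) (t₀, l₀) := by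
    have c1 : ContMDiff (((𝓡 1).prod (𝓡 1)).prod 𝓘(ℝ, Model 2 2)) 𝓘(ℝ, ℂ) n
      (fun q : T2 × Gr13 => (q.1.1 : ℂ)) := contMDiff_circle_coe.comp contMDiff_fst.fst
    have c2 : ContMDiff (((𝓡 1).prod (𝓡 1)).prod 𝓘(ℝ, Model 2 2)) 𝓘(ℝ, ℂ) n
      (fun q : T2 × Gr13 => (q.1.2 : ℂ)) := contMDiff_circle_coe.comp contMDiff_fst.snd
    have c3 : ContMDiffAt (((𝓡 1).prod (𝓡 1)).prod 𝓘(ℝ, Model 2 2)) 𝓘(ℝ, Model 2 2) n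
        (fun q : T2 × Gr13 => graphChart g q.2) (t₀, l₀) :=
      ((contMDiffOn_graphChart g).contMDiffAt ((isOpen_range_graphSub g).mem_nhds
        (mem_range_adapted l₀))).comp (t₀, l₀) contMDiffAt_snd
    exact (c1.contMDiffAt.prodMk_space c2.contMDiffAt).prodMk_space c3
  refine contMDiffAt_of_frame stdSplit
    (((hP.restrict_scalars ℝ).of_le (m := n) le_top).contMDiff.contMDiffAt.comp (t₀, l₀) hmap)
    (((hQ.restrict_scalars ℝ).of_le (m := n) le_top).contMDiff.contMDiffAt.comp (t₀, l₀) hmap) ?_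
  have hopen : ∀ᶠ q : T2 × Gr13 in 𝓝 (t₀, l₀), q.2 ∈ range (graphSub g) :=
    continuous_snd.continuousAt.eventually
      ((isOpen_range_graphSub g).mem_nhds (mem_range_adapted l₀))
  filter_upwards [hopen] with q hq
  change q.2.toSubmodule.map (torusLin q.1) = _
  conv_lhs => rw [← graphSub_graphChart g hq]
  change (LinearMap.range (graphMap g (graphChart g q.2))).map (torusLin q.1) = _
  rw [LinearMap.range_eq_map, ← Submodule.map_comp, ← LinearMap.range_eq_map]
  congr 1
  refine LinearMap.ext fun x => ?_
  change torusLin q.1 (g (x, graphChart g q.2 x)) =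
    stdSplit (N (((q.1.1 : ℂ), (q.1.2 : ℂ)), graphChart g q.2) x)
  have hx : g (x, graphChart g q.2 x) = g (x, 0) + g (0, graphChart g q.2 x) := by
    rw [← map_add]; simp
  rw [← LinearEquiv.symm_apply_eq, torusLin_eq, hx]
  simp only [N, C, LinearMap.add_apply, LinearMap.smul_apply, map_add, map_smul,
    ContinuousLinearMap.comp_apply, add_apply, smul_apply,
    ContinuousLinearMap.inl_apply, ContinuousLinearMap.inr_apply,
    LinearMap.coe_toContinuousLinearMap',
    LinearMap.comp_apply, LinearEquiv.coe_coe]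

theorem contMDiff_oneParam {n : WithTop ℕ∞} (i : Fin 2) :
    ContMDiff 𝓘(ℝ, ℝ) ((𝓡 1).prod (𝓡 1)) n (oneParam i) := by
  have h : ContMDiff 𝓘(ℝ, ℝ) (𝓡 1) n Circle.exp := contMDiff_circleExp
  fin_cases i
  · exact h.prodMk contMDiff_const
  · exact contMDiff_const.prodMk h

theorem oneParam_add (i : Fin 2) (θ θ' : ℝ) :
    oneParam i (θ + θ') = oneParam i θ * oneParam i θ' := by
  fin_cases i <;> simp [oneParam, Circle.exp_add]

theorem oneParam_zero (i : Fin 2) : oneParam i 0 = 1 := by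
  fin_cases i <;> simp [oneParam]

theorem contMDiff_orbit {n : WithTop ℕ∞} (i : Fin 2) (l : Gr13) :
    ContMDiff 𝓘(ℝ, ℝ) 𝓘(ℝ, Model 2 2) n (fun θ : ℝ => oneParam i θ • l) :=
by
  have h : ContMDiff 𝓘(ℝ, ℝ) (((𝓡 1).prod (𝓡 1)).prod 𝓘(ℝ, Model 2 2)) n
      (fun θ : ℝ => ((oneParam i θ, l) : T2 × Gr13)) :=
    (contMDiff_oneParam i).prodMk contMDiff_const
  have h' := contMDiff_torus_smul (n := n)
  intro θ
  exact (h' (oneParam i θ, l)).comp θ (h θ)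

/-- The infinitesimal generator of the action of the `i`-th coordinate circle. -/
def generator (i : Fin 2) (l : Gr13) : TangentSpace 𝓘(ℝ, Model 2 2) l :=
  (mfderiv 𝓘(ℝ, ℝ) 𝓘(ℝ, Model 2 2) (fun θ : ℝ => oneParam i θ • l) 0 : ℝ →L[ℝ] Model 2 2) 1

theorem hasMFDerivAt_orbit_zero (i : Fin 2) (l : Gr13) :
    HasMFDerivAt 𝓘(ℝ, ℝ) 𝓘(ℝ, Model 2 2) (fun θ : ℝ => oneParam i θ • l) 0
      ((1 : ℝ →L[ℝ] ℝ).smulRight (generator i l : Model 2 2)) := by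
  have hc : ContMDiff 𝓘(ℝ, ℝ) 𝓘(ℝ, Model 2 2) 1 (fun θ : ℝ => oneParam i θ • l) :=
    contMDiff_orbit i l
  have h := (hc.mdifferentiable one_ne_zero 0).hasMFDerivAt
  have key : ∀ L : ℝ →L[ℝ] Model 2 2, (1 : ℝ →L[ℝ] ℝ).smulRight (L 1) = L := fun L =>
    ContinuousLinearMap.ext_ring (by simp)
  exact (key (mfderiv 𝓘(ℝ, ℝ) 𝓘(ℝ, Model 2 2) (fun θ : ℝ => oneParam i θ • l) 0)).symm ▸ h

/-- By the group law, the orbit near `θ₀` is the orbit of the point reached at time `θ₀`, shifted in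
time; only the derivative at `0` is needed. -/
theorem isMIntegralCurve_orbit (i : Fin 2) (l : Gr13) :
    IsMIntegralCurve (I := 𝓘(ℝ, Model 2 2)) (fun θ : ℝ => oneParam i θ • l) (generator i) := by
  intro θ₀
  have h0 := hasMFDerivAt_orbit_zero i (oneParam i θ₀ • l)
  have hsub : HasMFDerivAt 𝓘(ℝ, ℝ) 𝓘(ℝ, ℝ) (fun θ : ℝ => θ - θ₀) θ₀ (ContinuousLinearMap.id ℝ ℝ) :=
    ((hasFDerivAt_id θ₀).sub_const θ₀).hasMFDerivAt
  have h1 : HasMFDerivAt 𝓘(ℝ, ℝ) 𝓘(ℝ, Model 2 2)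
      ((fun θ : ℝ => oneParam i θ • oneParam i θ₀ • l) ∘ fun θ => θ - θ₀) θ₀
      (((1 : ℝ →L[ℝ] ℝ).smulRight (generator i (oneParam i θ₀ • l) : Model 2 2)).comp
        (ContinuousLinearMap.id ℝ ℝ)) := by
    refine HasMFDerivAt.comp θ₀ ?_ hsub
    rw [sub_self]
    exact h0
  have hfun : ((fun θ : ℝ => oneParam i θ • oneParam i θ₀ • l) ∘ fun θ => θ - θ₀) =
      fun θ : ℝ => oneParam i θ • l := by
    funext θ
    simp only [Function.comp_apply, smul_smul, ← oneParam_add, sub_add_cancel]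
  rw [hfun] at h1
  exact h1

/-! ### The Hamiltonian property -/

/-- The quotient of quadratic forms on `Λ²ℂ⁴` that induces `μ̃ i`. -/
def pluckerMu (i : Fin 4) (w : Lambda2) : ℝ :=
  (∑ p, involves i p * ‖w p‖ ^ 2) / ∑ p, ‖w p‖ ^ 2

theorem mu_eq_pluckerMu {l : Gr13} (i : Fin 4) {u v : C4} (hu : u ∈ l.toSubmodule)
    (hv : v ∈ l.toSubmodule) (hw : wedge u v ≠ 0) : mu i l = pluckerMu i (wedge u v) := by
  rw [mu_eq_wedge i hu hv hw, EuclideanSpace.norm_sq_eq]; rfl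

theorem hasFDerivAt_norm_sq_coord (w : Lambda2) (p : {p : Fin 4 × Fin 4 // p.1 < p.2}) :
    HasFDerivAt (fun w : Lambda2 => ‖w p‖ ^ 2)
      ((2 • innerSL ℝ (w p)).comp ((EuclideanSpace.proj p : Lambda2 →L[ℂ] ℂ).restrictScalars ℝ))
      w := by
  have h : HasFDerivAt (fun w : Lambda2 => w p)
      ((EuclideanSpace.proj p : Lambda2 →L[ℂ] ℂ).restrictScalars ℝ) w :=
    ((EuclideanSpace.proj p : Lambda2 →L[ℂ] ℂ).restrictScalars ℝ).hasFDerivAt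
  exact h.norm_sq

/-- The quotient rule, arranged so that it matches `fubiniStudy_generator` term by term. -/
theorem exists_hasFDerivAt_pluckerMu (i : Fin 4) {w : Lambda2} (hw : w ≠ 0) :
    ∃ N' : Lambda2 →L[ℝ] ℝ, HasFDerivAt (pluckerMu i) N' w ∧ ∀ y, N' y =
      ((∑ p, involves i p * (2 * (conj (w p) * y p).re)) * (∑ p, ‖w p‖ ^ 2) -
        (∑ p, involves i p * ‖w p‖ ^ 2) * ∑ p, 2 * (conj (w p) * y p).re) /
        (∑ p, ‖w p‖ ^ 2) ^ 2 := by
  have hS : ∑ p, ‖w p‖ ^ 2 ≠ 0 := by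
    rw [← EuclideanSpace.norm_sq_eq]; exact pow_ne_zero 2 (norm_ne_zero_iff.2 hw)
  have h1 := HasFDerivAt.fun_sum (u := Finset.univ) (fun p _ =>
    (hasFDerivAt_norm_sq_coord w p).const_mul (involves i p))
  have h2 := HasFDerivAt.fun_sum (u := Finset.univ) (fun p _ => hasFDerivAt_norm_sq_coord w p)
  have h3 := h1.mul ((hasDerivAt_inv hS).comp_hasFDerivAt w h2)
  refine ⟨_, h3, fun y => ?_⟩
  simp [Complex.inner]
  simp only [mul_comm (Complex.re (w _)), mul_comm (Complex.im (w _))]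
  field_simp
  ring

/-- The vector `x` is the velocity `i D w` of the diagonal rotation plus a multiple of `w`. The
multiple is vertical for the projection to projective space and cancels between the two terms of the
form; what remains is the differential of the Rayleigh quotient of `D`. -/
theorem fubiniStudy_generator (i : Fin 4) {w : Lambda2} (hw : w ≠ 0) (c : ℂ) (x y : Lambda2)
    (hx : ∀ p, x p = c * w p + Complex.I * involves i p * w p) :
    fubiniStudy w y x =
      ((∑ p, involves i p * (2 * (conj (w p) * y p).re)) * (∑ p, ‖w p‖ ^ 2) -
        (∑ p, involves i p * ‖w p‖ ^ 2) * ∑ p, 2 * (conj (w p) * y p).re) /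
        (∑ p, ‖w p‖ ^ 2) ^ 2 := by
  have hn : ‖w‖ ^ 2 = ∑ p, ‖w p‖ ^ 2 := EuclideanSpace.norm_sq_eq w
  have hnc : (‖w‖ : ℂ) ^ 2 = ∑ p, w p * conj (w p) := by
    have : (‖w‖ : ℂ) ^ 2 = ((‖w‖ ^ 2 : ℝ) : ℂ) := by push_cast; rfl
    rw [this, hn]
    push_cast
    exact Finset.sum_congr rfl fun p _ => (Complex.mul_conj' _).symm
  have h1 : inner ℂ y x = c * inner ℂ y w + Complex.I * ∑ p, involves i p * (w p * conj (y p)) := by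
    simp only [PiLp.inner_apply, RCLike.inner_apply, hx, Finset.mul_sum, ← Finset.sum_add_distrib]
    exact Finset.sum_congr rfl fun p _ => by ring
  have h2 : inner ℂ w x = c * (‖w‖ : ℂ) ^ 2 +
      Complex.I * ((∑ p, involves i p * ‖w p‖ ^ 2 : ℝ) : ℂ) := by
    rw [hnc]
    simp only [PiLp.inner_apply, RCLike.inner_apply, hx, Finset.mul_sum, Complex.ofReal_sum,
      ← Finset.sum_add_distrib]
    refine Finset.sum_congr rfl fun p _ => ?_
    push_cast
    rw [← Complex.mul_conj']
    ring
  have h3 : (inner ℂ y w : ℂ).re = ∑ p, (conj (w p) * y p).re := by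
    simp only [PiLp.inner_apply, RCLike.inner_apply, Complex.re_sum]
    refine Finset.sum_congr rfl fun p _ => ?_
    simp
  have h4 : (∑ p, (involves i p : ℂ) * (w p * conj (y p))).re =
      ∑ p, involves i p * (conj (w p) * y p).re := by
    rw [Complex.re_sum]
    refine Finset.sum_congr rfl fun p _ => ?_
    simp
  have h5 : inner ℂ y x * (‖w‖ : ℂ) ^ 2 - inner ℂ y w * inner ℂ w x = Complex.I *
      ((∑ p, (involves i p : ℂ) * (w p * conj (y p))) * ((‖w‖ ^ 2 : ℝ) : ℂ) -
        inner ℂ y w * ((∑ p, involves i p * ‖w p‖ ^ 2 : ℝ) : ℂ)) := by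
    rw [h1, h2]; push_cast; ring
  rw [fubiniStudy, h5, Complex.I_mul_im, Complex.sub_re, Complex.re_mul_ofReal,
    Complex.re_mul_ofReal, h3, h4, ← hn]
  have e1 : ∀ f : {p : Fin 4 × Fin 4 // p.1 < p.2} → ℝ, ∑ p, 2 * f p = 2 * ∑ p, f p :=
    fun f => (Finset.mul_sum _ _ _).symm
  have e2 : ∑ p, involves i p * (2 * (conj (w p) * y p).re) =
      2 * ∑ p, involves i p * (conj (w p) * y p).re := by
    rw [← e1]; exact Finset.sum_congr rfl fun p _ => by ring
  rw [e1, e2]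
  have : ‖w‖ ≠ 0 := norm_ne_zero_iff.2 hw
  field_simp

/-- The second exterior power of a plane is a line; the factor is the determinant of the
coefficients. -/
theorem exists_wedge_eq_smul {l : Gr13} {u v x y : C4} (hu : u ∈ l.toSubmodule)
    (hv : v ∈ l.toSubmodule) (hw : wedge u v ≠ 0) (hx : x ∈ l.toSubmodule)
    (hy : y ∈ l.toSubmodule) : ∃ c : ℂ, ∀ p, wedge x y p = c * wedge u v p := by
  rw [span_eq_of_wedge_ne_zero hu hv hw, Submodule.mem_span_pair] at hx hy
  obtain ⟨a, b, rfl⟩ := hx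
  obtain ⟨a', b', rfl⟩ := hy
  refine ⟨a * b' - b * a', fun p => ?_⟩
  simp [wedge]
  ring

/-- The bivector of the frame of the graph of `A`. -/
def graphWedge (g : ((Fin 2 → ℂ) × (Fin 2 → ℂ)) ≃ₗ[ℂ] C4) (A : Model 2 2) : Lambda2 :=
  wedge (graphMap g A (Pi.single 0 1)) (graphMap g A (Pi.single 1 1))

theorem not_linearIndependent_of_wedge_eq_zero {u v : C4} (h : wedge u v = 0) :
    ¬ LinearIndependent ℂ ![u, v] := by
  intro hli
  rw [LinearIndependent.pair_iff] at hli
  have hc : ∀ i j, u i * v j = u j * v i := by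
    intro i j
    rcases lt_trichotomy i j with hij | rfl | hij
    · have := congrArg (fun z : Lambda2 => z ⟨(i, j), hij⟩) h
      simpa [wedge, sub_eq_zero] using this
    · rfl
    · have := congrArg (fun z : Lambda2 => z ⟨(j, i), hij⟩) h
      simp [wedge, sub_eq_zero] at this
      exact this.symm
  -- For each `j`, proportionality gives the linear relation `v j • u - u j • v = 0`.
  have hv : ∀ j, v j = 0 := fun j => by
    refine (hli (v j) (-u j) ?_).1
    ext i
    simp
    linear_combination hc i j
  exact one_ne_zero (hli 0 1 (by ext i; simp [hv])).2

theorem graphWedge_ne_zero (g : ((Fin 2 → ℂ) × (Fin 2 → ℂ)) ≃ₗ[ℂ] C4) (A : Model 2 2) :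
    graphWedge g A ≠ 0 := by
  intro h
  refine not_linearIndependent_of_wedge_eq_zero h ?_
  rw [LinearIndependent.pair_iff]
  intro s t hst
  rw [← map_smul, ← map_smul, ← map_add] at hst
  have h0 := graphMap_injective g A (hst.trans (map_zero _).symm)
  exact ⟨by simpa using congrFun h0 0, by simpa using congrFun h0 1⟩

theorem contDiff_graphWedge (g : ((Fin 2 → ℂ) × (Fin 2 → ℂ)) ≃ₗ[ℂ] C4) :
    ContDiff ℝ ω (graphWedge g) := by
  have hv : ∀ (z : Fin 2 → ℂ) (i : Fin 4), ContDiff ℂ ω (fun A => graphMap g A z i) := by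
    intro z i
    have : (fun A : Model 2 2 => graphMap g A z i) = fun A =>
        ((EuclideanSpace.proj i : C4 →L[ℂ] ℂ).comp g.toLinearMap.toContinuousLinearMap) (z, A z) := rfl
    rw [this]
    exact (ContinuousLinearMap.contDiff _).comp
      (contDiff_const.prodMk (contDiff_id.clm_apply contDiff_const))
  have h : ContDiff ℂ ω (graphWedge g) := by
    rw [contDiff_euclidean]
    intro p
    exact ((hv _ _).mul (hv _ _)).sub ((hv _ _).mul (hv _ _))
  exact h.restrict_scalars ℝ

theorem graphMap_mem {g : ((Fin 2 → ℂ) × (Fin 2 → ℂ)) ≃ₗ[ℂ] C4} {l : Gr13}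
    (hl : l ∈ range (graphSub g)) (x : Fin 2 → ℂ) :
    graphMap g (graphChart g l) x ∈ l.toSubmodule := by
  have h : graphMap g (graphChart g l) x ∈ (graphSub g (graphChart g l)).toSubmodule := ⟨x, rfl⟩
  rwa [graphSub_graphChart g hl] at h

theorem mu_eq_pluckerMu_graphWedge {g : ((Fin 2 → ℂ) × (Fin 2 → ℂ)) ≃ₗ[ℂ] C4} {l : Gr13}
    (hl : l ∈ range (graphSub g)) (i : Fin 4) :
    mu i l = pluckerMu i (graphWedge g (graphChart g l)) :=
  mu_eq_pluckerMu i (graphMap_mem hl _) (graphMap_mem hl _) (graphWedge_ne_zero g _)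

theorem contMDiffAt_plueckerLift (l : Gr13) :
    ContMDiffAt 𝓘(ℝ, Model 2 2) 𝓘(ℝ, Lambda2) ω (plueckerLift l) l :=
  (contDiff_graphWedge (adapted l)).contMDiff.contMDiffAt.comp l
    ((contMDiffOn_graphChart (adapted l)).contMDiffAt
      ((isOpen_range_graphSub _).mem_nhds (mem_range_adapted l)))

/-- `involves` is the weight of the circle on a Plücker coordinate; this identifies the operator of
the flow with the one defining `pluckerMu`. -/
theorem wedge_torusLin_oneParam (i : Fin 2) (θ : ℝ) (u v : C4)
    (p : {p : Fin 4 × Fin 4 // p.1 < p.2}) :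
    wedge (torusLin (oneParam i θ) u) (torusLin (oneParam i θ) v) p =
      Complex.exp (θ * Complex.I * involves (Fin.castLE (by norm_num) i) p) * wedge u v p := by
  have h : torusDiag (oneParam i θ) p.1.1 * torusDiag (oneParam i θ) p.1.2 =
      Complex.exp (θ * Complex.I * involves (Fin.castLE (by norm_num) i) p) := by
    fin_cases i <;> fin_cases p <;>
      simp [torusDiag, oneParam, involves, Circle.coe_exp]
  rw [← h]
  simp [wedge, torusLin]
  ring

/-- The derivative of the Plücker lift along an orbit, modulo the line of the lift itself. -/
theorem exists_mfderiv_plueckerLift_generator (i : Fin 2) (l : Gr13) : ∃ c : ℂ, ∀ p,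
    WithLp.ofLp (mfderiv 𝓘(ℝ, Model 2 2) 𝓘(ℝ, Lambda2) (plueckerLift l) l (generator i l)) p =
      c * plueckerLift l l p +
        Complex.I * involves (Fin.castLE (by norm_num) i) p * plueckerLift l l p := by
  set g := adapted l
  set w := plueckerLift l l with hw
  set j : Fin 4 := Fin.castLE (by norm_num) i
  have hw0 : w ≠ 0 := graphWedge_ne_zero g _
  -- A nonzero coordinate serves to eliminate the scalar by which the lift and the rotated bivector
  -- differ.
  obtain ⟨q, hq⟩ : ∃ q, w q ≠ 0 := by
    by_contra! h
    exact hw0 (by ext p; exact h p)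
  set ξ : Lambda2 := mfderiv 𝓘(ℝ, Model 2 2) 𝓘(ℝ, Lambda2) (plueckerLift l) l (generator i l)
  have hL : HasMFDerivAt 𝓘(ℝ, Model 2 2) 𝓘(ℝ, Lambda2) (plueckerLift l) l
      (mfderiv 𝓘(ℝ, Model 2 2) 𝓘(ℝ, Lambda2) (plueckerLift l) l) :=
    ((contMDiffAt_plueckerLift l).mdifferentiableAt (by simp)).hasMFDerivAt
  let γ : ℝ → Gr13 := fun θ => oneParam i θ • l
  have hγ0 : γ 0 = l := by simp only [γ, oneParam_zero, one_smul]
  have hγ : HasMFDerivAt 𝓘(ℝ, ℝ) 𝓘(ℝ, Model 2 2) γ 0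
      ((1 : ℝ →L[ℝ] ℝ).smulRight (generator i l : Model 2 2)) := hasMFDerivAt_orbit_zero i l
  have hcoord : ∀ p, HasDerivAt (fun θ => plueckerLift l (γ θ) p) (ξ p) 0 := by
    intro p
    have h1 : HasMFDerivAt 𝓘(ℝ, ℝ) 𝓘(ℝ, Lambda2) (plueckerLift l ∘ γ) 0
        ((mfderiv 𝓘(ℝ, Model 2 2) 𝓘(ℝ, Lambda2) (plueckerLift l) l).comp
          ((1 : ℝ →L[ℝ] ℝ).smulRight (generator i l : Model 2 2))) := by
      refine HasMFDerivAt.comp 0 ?_ hγ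
      rw [hγ0]; exact hL
    have h2 : HasDerivAt (fun θ => plueckerLift l (γ θ) p)
        (WithLp.ofLp (mfderiv 𝓘(ℝ, Model 2 2) 𝓘(ℝ, Lambda2) (plueckerLift l) l
          ((1 : ℝ →L[ℝ] ℝ).smulRight (generator i l : Model 2 2) 1)) p) 0 :=
      (((EuclideanSpace.proj p : Lambda2 →L[ℂ] ℂ).restrictScalars ℝ).hasFDerivAt.comp 0
        h1.hasFDerivAt).hasDerivAt
    have h3 : (1 : ℝ →L[ℝ] ℝ).smulRight (generator i l : Model 2 2) 1 = generator i l := by simp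
    rw [h3] at h2
    exact h2
  have hev : ∀ᶠ θ in 𝓝 (0 : ℝ), γ θ ∈ range (graphSub g) := by
    have : ContinuousAt γ 0 := (contMDiff_orbit (n := 0) i l).continuous.continuousAt
    refine this.eventually ((isOpen_range_graphSub g).mem_nhds ?_)
    rw [hγ0]; exact mem_range_adapted l
  -- The constant is forced by the case `p = q` of the claim.
  refine ⟨ξ q / w q - Complex.I * involves j q, fun p => ?_⟩
  -- Along the orbit the lift is a scalar `c(θ)` times the rotated bivector. Nothing is known about
  -- the regularity of `c`, so it is expressed through the `q`-coordinate of the lift, which is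
  -- differentiable.
  have hform : (fun θ => plueckerLift l (γ θ) p) =ᶠ[𝓝 0] fun θ =>
      plueckerLift l (γ θ) q * (w p / w q) *
        Complex.exp ((θ : ℂ) * (Complex.I * (involves j p - involves j q))) := by
    filter_upwards [hev] with θ hθ
    have hmem := graphMap_mem (mem_range_adapted l)
    obtain ⟨c, hc⟩ := exists_wedge_eq_smul (l := γ θ)
      (u := torusLin (oneParam i θ) (graphMap g (graphChart g l) (Pi.single 0 1)))
      (v := torusLin (oneParam i θ) (graphMap g (graphChart g l) (Pi.single 1 1)))
      ⟨_, hmem _, rfl⟩ ⟨_, hmem _, rfl⟩ (by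
        intro h0
        have := congrArg (fun z : Lambda2 => z q) h0
        simp only [wedge_torusLin_oneParam] at this
        exact mul_ne_zero (Complex.exp_ne_zero _) hq this)
      (graphMap_mem hθ (Pi.single 0 1)) (graphMap_mem hθ (Pi.single 1 1))
    have hp := hc p
    have hq' := hc q
    rw [wedge_torusLin_oneParam] at hp hq'
    change plueckerLift l (γ θ) p = c * (_ * w p) at hp
    change plueckerLift l (γ θ) q = c * (_ * w q) at hq'
    rw [hp, hq']
    have hexp : Complex.exp (θ * Complex.I * involves j p) = Complex.exp (θ * Complex.I * involves j q)
        * Complex.exp ((θ : ℂ) * (Complex.I * (involves j p - involves j q))) := by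
      rw [← Complex.exp_add]; congr 1; ring
    change _ = c * (Complex.exp (θ * Complex.I * involves j q) * w q) * (w p / w q) * _
    change c * (Complex.exp (θ * Complex.I * involves j p) * w p) = _
    rw [hexp]
    field_simp
  have hexp : HasDerivAt (fun θ : ℝ =>
      Complex.exp ((θ : ℂ) * (Complex.I * (involves j p - involves j q))))
      (Complex.I * (involves j p - involves j q)) 0 := by
    have h1 : HasDerivAt (fun θ : ℝ => (θ : ℂ) * (Complex.I * (involves j p - involves j q)))
      (Complex.I * (involves j p - involves j q)) 0 := by
      simpa using (Complex.ofRealCLM.hasDerivAt (x := (0 : ℝ))).mul_const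
        (Complex.I * ((involves j p : ℂ) - involves j q))
    simpa using h1.cexp
  have hd := (((hcoord q).mul_const (w p / w q)).mul hexp).congr_of_eventuallyEq hform
  rw [(hcoord p).unique hd, hγ0, ← hw]
  simp
  field_simp
  ring

/-- Near `l` the function is `pluckerMu` composed with the local lift, so the chain rule reduces the
claim to `fubiniStudy_generator` at the lifted point. -/
theorem isHamiltonianField_generator (i : Fin 2) :
    IsHamiltonianField (mu (Fin.castLE (by norm_num) i)) (generator i) := by
  intro l
  set j : Fin 4 := Fin.castLE (by norm_num) i
  set w := plueckerLift l l with hw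
  have hw0 : w ≠ 0 := graphWedge_ne_zero (adapted l) _
  obtain ⟨N', hN, hN'⟩ := exists_hasFDerivAt_pluckerMu j hw0
  have hL : HasMFDerivAt 𝓘(ℝ, Model 2 2) 𝓘(ℝ, Lambda2) (plueckerLift l) l
      (mfderiv 𝓘(ℝ, Model 2 2) 𝓘(ℝ, Lambda2) (plueckerLift l) l) :=
    ((contMDiffAt_plueckerLift l).mdifferentiableAt (by simp)).hasMFDerivAt
  have hcomp : HasMFDerivAt 𝓘(ℝ, Model 2 2) 𝓘(ℝ, ℝ) (pluckerMu j ∘ plueckerLift l) l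
      (N'.comp (mfderiv 𝓘(ℝ, Model 2 2) 𝓘(ℝ, Lambda2) (plueckerLift l) l)) :=
    HasMFDerivAt.comp l hN.hasMFDerivAt hL
  have hmu : HasMFDerivAt 𝓘(ℝ, Model 2 2) 𝓘(ℝ, ℝ) (mu j) l
      (N'.comp (mfderiv 𝓘(ℝ, Model 2 2) 𝓘(ℝ, Lambda2) (plueckerLift l) l)) := by
    refine hcomp.congr_of_eventuallyEq ?_
    filter_upwards [(isOpen_range_graphSub (adapted l)).mem_nhds (mem_range_adapted l)] with l' hl'
    exact mu_eq_pluckerMu_graphWedge hl' j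
  refine ⟨hmu.mdifferentiableAt, fun Y => ?_⟩
  rw [hmu.mfderiv]
  obtain ⟨c, hc⟩ := exists_mfderiv_plueckerLift_generator i l
  exact (hN' _).trans (fubiniStudy_generator j hw0 c _ _ hc).symm

/-! ### Inverting `(p, q) ↦ (μ̃₀, μ̃₁)` on a fibre

On a fibre of `τ` the values of `μ̃₀`, `μ̃₁` are `(p + m) / S`, `(q + m) / S` where `m = k p q`,
`S = 1 + p + q + m`, with a parameter `k ≥ 0` of the base. -/

/-- The odds `c₀ / (1 - c₀ - c₁)`. -/
def odds₀ (c : ℝ × ℝ) : ℝ := c.1 / (1 - c.1 - c.2)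

/-- The odds `c₁ / (1 - c₀ - c₁)`. -/
def odds₁ (c : ℝ × ℝ) : ℝ := c.2 / (1 - c.1 - c.2)

/-- The discriminant of the quadratic equation for `m = k p q`. -/
def fibreDisc (k : ℝ) (c : ℝ × ℝ) : ℝ :=
  1 + 2 * k * (odds₀ c + odds₁ c + 2 * odds₀ c * odds₁ c) + k ^ 2 * (odds₀ c - odds₁ c) ^ 2

/-- The smaller root of the quadratic equation for `m = k p q`. -/
def fibreRoot (k : ℝ) (c : ℝ × ℝ) : ℝ :=
  2 * (k * odds₀ c * odds₁ c) /
    (1 + k * (odds₀ c + odds₁ c + 2 * odds₀ c * odds₁ c) + √(fibreDisc k c))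

/-- The value of `p`. -/
def fibreSol₀ (k : ℝ) (c : ℝ × ℝ) : ℝ := odds₀ c * (1 - fibreRoot k c) - fibreRoot k c

/-- The value of `q`. -/
def fibreSol₁ (k : ℝ) (c : ℝ × ℝ) : ℝ := odds₁ c * (1 - fibreRoot k c) - fibreRoot k c

theorem odds₀_pos {c : ℝ × ℝ} (hc : c ∈ Triangle) : 0 < odds₀ c :=
  div_pos hc.1 (by have := hc.2.2; linarith)

theorem odds₁_pos {c : ℝ × ℝ} (hc : c ∈ Triangle) : 0 < odds₁ c :=
  div_pos hc.2.1 (by have := hc.2.2; linarith)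

theorem fibreDisc_pos {k : ℝ} {c : ℝ × ℝ} (hk : 0 ≤ k) (hc : c ∈ Triangle) :
    0 < fibreDisc k c := by
  have := odds₀_pos hc
  have := odds₁_pos hc
  unfold fibreDisc
  positivity

theorem fibreRoot_den_pos {k : ℝ} {c : ℝ × ℝ} (hk : 0 ≤ k) (hc : c ∈ Triangle) :
    0 < 1 + k * (odds₀ c + odds₁ c + 2 * odds₀ c * odds₁ c) + √(fibreDisc k c) := by
  have := odds₀_pos hc
  have := odds₁_pos hc
  positivity

/-- The discriminant exceeds `k² (α - β)²` by at least `1`, where `α`, `β` are the odds. -/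
theorem abs_lt_sqrt_fibreDisc {k : ℝ} {c : ℝ × ℝ} (hk : 0 ≤ k) (hc : c ∈ Triangle) :
    |k * (odds₀ c - odds₁ c)| < √(fibreDisc k c) := by
  have h0 := odds₀_pos hc
  have h1 := odds₁_pos hc
  refine Real.lt_sqrt_of_sq_lt ?_
  rw [sq_abs, fibreDisc]
  have : 0 ≤ 2 * k * (odds₀ c + odds₁ c + 2 * odds₀ c * odds₁ c) := by positivity
  nlinarith

theorem fibreSol₀_pos {k : ℝ} {c : ℝ × ℝ} (hk : 0 ≤ k) (hc : c ∈ Triangle) :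
    0 < fibreSol₀ k c := by
  have h0 := odds₀_pos hc
  have hd := fibreRoot_den_pos hk hc
  have hs := (abs_lt.1 (abs_lt_sqrt_fibreDisc hk hc)).1
  -- After clearing the denominator and cancelling the odds `α > 0`, this says `k (β - α) < 1 +
  -- √disc`.
  have : fibreRoot k c * (1 + odds₀ c) < odds₀ c := by
    rw [fibreRoot, div_mul_eq_mul_div, div_lt_iff₀ hd]
    nlinarith
  rw [fibreSol₀]; linarith

theorem fibreSol₁_pos {k : ℝ} {c : ℝ × ℝ} (hk : 0 ≤ k) (hc : c ∈ Triangle) :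
    0 < fibreSol₁ k c := by
  have h1 := odds₁_pos hc
  have hd := fibreRoot_den_pos hk hc
  have hs := (abs_lt.1 (abs_lt_sqrt_fibreDisc hk hc)).2
  have : fibreRoot k c * (1 + odds₁ c) < odds₁ c := by
    rw [fibreRoot, div_mul_eq_mul_div, div_lt_iff₀ hd]
    nlinarith
  rw [fibreSol₁]; linarith

/-- Substituting `p = α (1 - m) - m` and `q = β (1 - m) - m` into `m = k p q` gives `k (1 + α)(1 +
β) m² - (1 + k (α + β + 2αβ)) m + k α β = 0`. The rationalized form of the smaller root stays valid
at `k = 0`, where the leading coefficient vanishes; this happens exactly when the two base points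
coincide. -/
theorem mul_fibreSol {k : ℝ} {c : ℝ × ℝ} (hk : 0 ≤ k) (hc : c ∈ Triangle) :
    k * fibreSol₀ k c * fibreSol₁ k c = fibreRoot k c := by
  have hd := fibreRoot_den_pos hk hc
  have hs : √(fibreDisc k c) ^ 2 = fibreDisc k c := Real.sq_sqrt (fibreDisc_pos hk hc).le
  rw [fibreSol₀, fibreSol₁, fibreRoot]
  set s := √(fibreDisc k c)
  rw [fibreDisc] at hs
  set a := odds₀ c
  set b := odds₁ c
  set D := 1 + k * (a + b + 2 * a * b) + s with hD
  have hs' : s = D - (1 + k * (a + b + 2 * a * b)) := by rw [hD]; ring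
  rw [hs'] at hs
  have hD0 : D ≠ 0 := hd.ne'
  field_simp
  linear_combination (k * a * b) * hs

theorem odds_identity {c : ℝ × ℝ} (hc : c ∈ Triangle) :
    odds₀ c = c.1 * (1 + odds₀ c + odds₁ c) ∧ odds₁ c = c.2 * (1 + odds₀ c + odds₁ c) := by
  have : 1 - c.1 - c.2 ≠ 0 := by have := hc.2.2; linarith
  rw [odds₀, odds₁]
  constructor <;> · field_simp; ring

theorem fibreSol_spec {k : ℝ} {c : ℝ × ℝ} (hk : 0 ≤ k) (hc : c ∈ Triangle) :
    (fibreSol₀ k c + k * fibreSol₀ k c * fibreSol₁ k c) /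
        (1 + fibreSol₀ k c + fibreSol₁ k c + k * fibreSol₀ k c * fibreSol₁ k c) = c.1 ∧
      (fibreSol₁ k c + k * fibreSol₀ k c * fibreSol₁ k c) /
        (1 + fibreSol₀ k c + fibreSol₁ k c + k * fibreSol₀ k c * fibreSol₁ k c) = c.2 := by
  have h0 := fibreSol₀_pos hk hc
  have h1 := fibreSol₁_pos hk hc
  have hS : 0 < 1 + fibreSol₀ k c + fibreSol₁ k c + k * fibreSol₀ k c * fibreSol₁ k c := by
    positivity
  obtain ⟨e0, e1⟩ := odds_identity hc
  -- With `m` the root, `p + m = α (1 - m)` and `S = (1 - m)(1 + α + β)`, so the quotients reduce to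
  -- `odds_identity`.
  rw [div_eq_iff hS.ne', div_eq_iff hS.ne', mul_fibreSol hk hc, fibreSol₀, fibreSol₁]
  constructor
  · linear_combination (1 - fibreRoot k c) * e0
  · linear_combination (1 - fibreRoot k c) * e1

theorem fibreSol_unique {k p q : ℝ} {c : ℝ × ℝ} (hk : 0 ≤ k) (hp : 0 < p) (hq : 0 < q)
    (hm : k * p * q < 1) (h0 : c.1 = (p + k * p * q) / (1 + p + q + k * p * q))
    (h1 : c.2 = (q + k * p * q) / (1 + p + q + k * p * q)) :
    c ∈ Triangle ∧ fibreSol₀ k c = p ∧ fibreSol₁ k c = q := by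
  have hm0 : 0 ≤ k * p * q := by positivity
  have hS : 0 < 1 + p + q + k * p * q := by positivity
  have h2 : 1 - c.1 - c.2 = (1 - k * p * q) / (1 + p + q + k * p * q) := by
    rw [h0, h1]; field_simp; ring
  have hc : c ∈ Triangle := by
    refine ⟨by rw [h0]; positivity, by rw [h1]; positivity, ?_⟩
    have : 0 < 1 - c.1 - c.2 := by rw [h2]; exact div_pos (by linarith) hS
    linarith
  refine ⟨hc, ?_⟩
  have hm1 : 1 - k * p * q ≠ 0 := by linarith
  have o0 : odds₀ c * (1 - k * p * q) = p + k * p * q := by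
    rw [odds₀, h2, h0, div_div_div_cancel_right₀ hS.ne', div_mul_cancel₀ _ hm1]
  have o1 : odds₁ c * (1 - k * p * q) = q + k * p * q := by
    rw [odds₁, h2, h1, div_div_div_cancel_right₀ hS.ne', div_mul_cancel₀ _ hm1]
  have hr := mul_fibreSol hk hc
  have p0 := fibreSol₀_pos hk hc
  have p1 := fibreSol₁_pos hk hc
  have a0 := odds₀_pos hc
  have a1 := odds₁_pos hc
  -- Monotonicity replaces a choice between roots: `p` and `q` decrease as `m` grows, while `m = k p
  -- q` increases with `p` and `q`. Hence either inequality between two candidate values of `m`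
  -- implies the opposite one.
  have key : fibreRoot k c = k * p * q := by
    rcases le_total (fibreRoot k c) (k * p * q) with h | h
    · refine le_antisymm h ?_
      have e0 : p ≤ fibreSol₀ k c := by rw [fibreSol₀]; nlinarith
      have e1 : q ≤ fibreSol₁ k c := by rw [fibreSol₁]; nlinarith
      rw [← hr, mul_assoc, mul_assoc]
      exact mul_le_mul_of_nonneg_left (mul_le_mul e0 e1 hq.le p0.le) hk
    · refine le_antisymm ?_ h
      have e0 : fibreSol₀ k c ≤ p := by rw [fibreSol₀]; nlinarith
      have e1 : fibreSol₁ k c ≤ q := by rw [fibreSol₁]; nlinarith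
      rw [← hr, mul_assoc, mul_assoc]
      exact mul_le_mul_of_nonneg_left (mul_le_mul e0 e1 p1.le hp.le) hk
  rw [fibreSol₀, fibreSol₁, key, o0, o1]
  constructor <;> ring

/-- The radicand and all denominators are nonzero on the triangle for `k ≥ 0`, so the formulas are
analytic up to and including `k = 0`. -/
theorem contDiffAt_fibreSol {k : ℝ} {c : ℝ × ℝ} (hk : 0 ≤ k) (hc : c ∈ Triangle) :
    ContDiffAt ℝ ω (fun z : ℝ × ℝ × ℝ => fibreSol₀ z.1 z.2) (k, c) ∧
      ContDiffAt ℝ ω (fun z : ℝ × ℝ × ℝ => fibreSol₁ z.1 z.2) (k, c) := by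
  have hd : (1 - c.1 - c.2) ≠ 0 := by have := hc.2.2; linarith
  have hk' : ContDiffAt ℝ ω (fun z : ℝ × ℝ × ℝ => z.1) (k, c) := contDiffAt_fst
  have h1 : ContDiffAt ℝ ω (fun z : ℝ × ℝ × ℝ => z.2.1) (k, c) := contDiffAt_snd.fst
  have h2 : ContDiffAt ℝ ω (fun z : ℝ × ℝ × ℝ => z.2.2) (k, c) := contDiffAt_snd.snd
  have o0 : ContDiffAt ℝ ω (fun z : ℝ × ℝ × ℝ => odds₀ z.2) (k, c) :=
    h1.div ((contDiffAt_const.sub h1).sub h2) hd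
  have o1 : ContDiffAt ℝ ω (fun z : ℝ × ℝ × ℝ => odds₁ z.2) (k, c) :=
    h2.div ((contDiffAt_const.sub h1).sub h2) hd
  have hmix : ContDiffAt ℝ ω (fun z : ℝ × ℝ × ℝ => odds₀ z.2 + odds₁ z.2 +
      2 * odds₀ z.2 * odds₁ z.2) (k, c) :=
    (o0.add o1).add ((contDiffAt_const.mul o0).mul o1)
  have hdisc : ContDiffAt ℝ ω (fun z : ℝ × ℝ × ℝ => √(fibreDisc z.1 z.2)) (k, c) :=
    ((contDiffAt_const.add ((contDiffAt_const.mul hk').mul hmix)).add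
      ((hk'.pow 2).mul ((o0.sub o1).pow 2))).sqrt (fibreDisc_pos hk hc).ne'
  have hroot : ContDiffAt ℝ ω (fun z : ℝ × ℝ × ℝ => fibreRoot z.1 z.2) (k, c) :=
    (contDiffAt_const.mul ((hk'.mul o0).mul o1)).div
      ((contDiffAt_const.add (hk'.mul hmix)).add hdisc) (fibreRoot_den_pos hk hc).ne'
  exact ⟨(o0.mul (contDiffAt_const.sub hroot)).sub hroot,
    (o1.mul (contDiffAt_const.sub hroot)).sub hroot⟩

/-! ### Coordinates on `Gr⁰(1,3)` -/

/-- The squared Hermitian norm on `ℂ²`. -/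
def sqNorm (a : Fin 2 → ℂ) : ℝ := ‖a 0‖ ^ 2 + ‖a 1‖ ^ 2

/-- The determinant of two vectors of `ℂ²`. -/
def det₂ (a b : Fin 2 → ℂ) : ℂ := a 0 * b 1 - a 1 * b 0

/-- The Hermitian product on `ℂ²`. -/
def herm (a b : Fin 2 → ℂ) : ℂ := conj (a 0) * b 0 + conj (a 1) * b 1

/-- A generator of the kernel of the linear form with coefficients `a`. -/
def perp (a : Fin 2 → ℂ) : Fin 2 → ℂ := ![a 1, -a 0]

theorem perp_smul (c : ℂ) (a : Fin 2 → ℂ) : perp (c • a) = c • perp a := by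
  ext i; fin_cases i <;> simp [perp]

theorem perp_perp (a : Fin 2 → ℂ) : perp (perp a) = -a := by
  ext i; fin_cases i <;> simp [perp]

theorem sqNorm_perp (a : Fin 2 → ℂ) : sqNorm (perp a) = sqNorm a := by
  simp [sqNorm, perp, add_comm]

theorem sqNorm_smul (c : ℂ) (a : Fin 2 → ℂ) : sqNorm (c • a) = ‖c‖ ^ 2 * sqNorm a := by
  simp [sqNorm]; ring

theorem det₂_smul_smul (c d : ℂ) (a b : Fin 2 → ℂ) :
    det₂ (c • a) (d • b) = c * d * det₂ a b := by
  simp [det₂]; ring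

theorem herm_smul (c : ℂ) (a b : Fin 2 → ℂ) : herm a (c • b) = c * herm a b := by
  simp [herm]; ring

theorem herm_self (a : Fin 2 → ℂ) : herm a a = sqNorm a := by
  simp [herm, sqNorm, Complex.conj_mul']

theorem sqNorm_nonneg (a : Fin 2 → ℂ) : 0 ≤ sqNorm a := by unfold sqNorm; positivity

theorem sqNorm_eq_zero {a : Fin 2 → ℂ} : sqNorm a = 0 ↔ a = 0 := by
  constructor
  · intro h
    have h0 : ‖a 0‖ ^ 2 = 0 := by unfold sqNorm at h; nlinarith [sq_nonneg ‖a 0‖, sq_nonneg ‖a 1‖]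
    have h1 : ‖a 1‖ ^ 2 = 0 := by unfold sqNorm at h; nlinarith [sq_nonneg ‖a 0‖, sq_nonneg ‖a 1‖]
    ext i; fin_cases i
    · simpa using h0
    · simpa using h1
  · rintro rfl; simp [sqNorm]

theorem sqNorm_pos {a : Fin 2 → ℂ} : 0 < sqNorm a ↔ a ≠ 0 := by
  rw [(sqNorm_nonneg a).lt_iff_ne, ne_comm, Ne, sqNorm_eq_zero]

theorem perp_ne_zero {a : Fin 2 → ℂ} (h : a ≠ 0) : perp a ≠ 0 := by
  rwa [← sqNorm_pos, sqNorm_perp, sqNorm_pos]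

/-- The matrix unit of `Hom(ℂ², ℂ²)`. -/
def matUnit (i j : Fin 2) : Model 2 2 :=
  (ContinuousLinearMap.proj (R := ℂ) (φ := fun _ : Fin 2 => ℂ) j).smulRight (Pi.single i 1)

/-- The map `ℂ² → ℂ²` with prescribed rows. -/
def ofRows (a b : Fin 2 → ℂ) : Model 2 2 :=
  a 0 • matUnit 0 0 + a 1 • matUnit 0 1 + b 0 • matUnit 1 0 + b 1 • matUnit 1 1

/-- The `i`-th row of a map `ℂ² → ℂ²`. -/
def row (A : Model 2 2) (i : Fin 2) : Fin 2 → ℂ := fun j => A (Pi.single j 1) i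

theorem ofRows_apply (a b x : Fin 2 → ℂ) :
    ofRows a b x = ![a 0 * x 0 + a 1 * x 1, b 0 * x 0 + b 1 * x 1] := by
  ext i; fin_cases i <;> simp [ofRows, matUnit, smul_smul]

theorem row_ofRows_zero (a b : Fin 2 → ℂ) : row (ofRows a b) 0 = a := by
  ext j; fin_cases j <;> simp [row, ofRows_apply]

theorem row_ofRows_one (a b : Fin 2 → ℂ) : row (ofRows a b) 1 = b := by
  ext j; fin_cases j <;> simp [row, ofRows_apply]

theorem apply_eq_row (A : Model 2 2) (x : Fin 2 → ℂ) (i : Fin 2) :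
    A x i = row A i 0 * x 0 + row A i 1 * x 1 := by
  have hx : x = x 0 • Pi.single 0 1 + x 1 • Pi.single 1 1 := by
    ext j; fin_cases j <;> simp
  conv_lhs => rw [hx]
  simp [row, mul_comm]

theorem ofRows_row (A : Model 2 2) : ofRows (row A 0) (row A 1) = A := by
  ext1 x
  ext i
  rw [apply_eq_row, apply_eq_row]
  fin_cases i
  · rw [Fin.zero_eta, row_ofRows_zero]
  · rw [Fin.mk_one, row_ofRows_one]

/-! ### The functions `mu 0`, `mu 1` and the set `Gr0` in the standard affine chart. -/

theorem graphWedge_stdSplit (A : Model 2 2) (p : {p : Fin 4 × Fin 4 // p.1 < p.2}) :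
    graphWedge stdSplit A p =
      ![row A 0 0, row A 1 0, 1, 0] p.1.1 * ![row A 0 1, row A 1 1, 0, 1] p.1.2 -
        ![row A 0 0, row A 1 0, 1, 0] p.1.2 * ![row A 0 1, row A 1 1, 0, 1] p.1.1 := by
  have h0 : graphMap stdSplit A (Pi.single 0 1) = WithLp.toLp 2 ![row A 0 0, row A 1 0, 1, 0] := by
    ext i; fin_cases i <;> simp [stdSplit, row]
  have h1 : graphMap stdSplit A (Pi.single 1 1) = WithLp.toLp 2 ![row A 0 1, row A 1 1, 0, 1] := by
    ext i; fin_cases i <;> simp [stdSplit, row]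
  rw [graphWedge, h0, h1]; rfl

/-- In the graph frame `w₂₃ = 1`, `w₀₁` is the determinant of the rows, and the other four Plücker
coordinates are the matrix entries up to sign. -/
theorem mu_graphSub (A : Model 2 2) :
    mu 0 (graphSub stdSplit A) = (sqNorm (row A 0) + ‖det₂ (row A 0) (row A 1)‖ ^ 2) /
      (1 + sqNorm (row A 0) + sqNorm (row A 1) + ‖det₂ (row A 0) (row A 1)‖ ^ 2) ∧
    mu 1 (graphSub stdSplit A) = (sqNorm (row A 1) + ‖det₂ (row A 0) (row A 1)‖ ^ 2) /
      (1 + sqNorm (row A 0) + sqNorm (row A 1) + ‖det₂ (row A 0) (row A 1)‖ ^ 2) := by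
  constructor
  all_goals
    rw [mu_eq_pluckerMu_graphWedge (mem_range_self A), graphChart_graphSub, pluckerMu, sum_pairs,
      sum_pairs]
    simp only [graphWedge_stdSplit]
    simp [involves, sqNorm, det₂, mul_comm (row A 1 0)]
    congr 1 <;> ring

theorem graphSub_normalization_pos (A : Model 2 2) :
    0 < 1 + sqNorm (row A 0) + sqNorm (row A 1) + ‖det₂ (row A 0) (row A 1)‖ ^ 2 := by
  have := sqNorm_nonneg (row A 0)
  have := sqNorm_nonneg (row A 1)
  positivity

theorem graphSub_mem_Gr0 (A : Model 2 2) : graphSub stdSplit A ∈ Gr0 ↔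
    row A 0 ≠ 0 ∧ row A 1 ≠ 0 ∧ ‖det₂ (row A 0) (row A 1)‖ ^ 2 < 1 := by
  have hS := graphSub_normalization_pos A
  obtain ⟨h0, h1⟩ := mu_graphSub A
  have hsum : mu 0 (graphSub stdSplit A) + mu 1 (graphSub stdSplit A) < 1 ↔
      ‖det₂ (row A 0) (row A 1)‖ ^ 2 < 1 := by
    rw [h0, h1, ← add_div, div_lt_one hS]
    constructor <;> intro h <;> linarith
  change 0 < mu 0 _ ∧ 0 < mu 1 _ ∧ mu 0 _ + mu 1 _ < 1 ↔ _
  rw [hsum, h0, h1, div_pos_iff_of_pos_right hS, div_pos_iff_of_pos_right hS]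
  have key : ∀ a b : Fin 2 → ℂ, a = 0 ∨ b = 0 → det₂ a b = 0 := by
    rintro a b (rfl | rfl) <;> simp [det₂]
  refine and_congr ?_ (and_congr ?_ Iff.rfl)
  · constructor
    · intro h ha
      rw [key _ _ (Or.inl ha), ha] at h
      simp [sqNorm] at h
    · intro h
      have := sqNorm_pos.2 h
      positivity
  · constructor
    · intro h ha
      rw [key _ _ (Or.inr ha), ha] at h
      simp [sqNorm] at h
    · intro h
      have := sqNorm_pos.2 h
      positivity

theorem Gr0_subset_range : Gr0 ⊆ range (graphSub stdSplit) := by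
  intro l hl
  set u := graphMap (adapted l) (graphChart (adapted l) l) (Pi.single 0 1) with hu
  set v := graphMap (adapted l) (graphChart (adapted l) l) (Pi.single 1 1) with hv
  have hul : u ∈ l.toSubmodule := graphMap_mem (mem_range_adapted l) _
  have hvl : v ∈ l.toSubmodule := graphMap_mem (mem_range_adapted l) _
  have hw : wedge u v ≠ 0 := graphWedge_ne_zero _ _
  -- In `mu 0 + mu 1` the coordinate `w₀₁` is counted twice and `w₂₃` not at all, so the sum is
  -- below `1` only if `|w₀₁| < |w₂₃|`.
  have hD : u 2 * v 3 - u 3 * v 2 ≠ 0 := by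
    intro h
    have h3 := hl.2.2
    have hpos : 0 < ∑ p, ‖wedge u v p‖ ^ 2 := by
      rw [← EuclideanSpace.norm_sq_eq]
      have := norm_pos_iff.2 hw
      positivity
    rw [mu_eq_pluckerMu 0 hul hvl hw, mu_eq_pluckerMu 1 hul hvl hw, pluckerMu, pluckerMu,
      ← add_div, div_lt_one hpos, sum_pairs, sum_pairs, sum_pairs] at h3
    have h23 : wedge u v ⟨(2, 3), by decide⟩ = 0 := h
    rw [h23] at h3
    simp [involves] at h3
    nlinarith [sq_nonneg ‖wedge u v ⟨(0, 1), by decide⟩‖]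
  set D := u 2 * v 3 - u 3 * v 2
  -- Cramer's rule: `x`, `y` is the basis of `l` whose `(z₂, z₃)`-parts are `(1, 0)` and `(0, 1)`;
  -- their first two entries are the columns of the matrix.
  let x : C4 := D⁻¹ • (v 3 • u - u 3 • v)
  let y : C4 := D⁻¹ • (u 2 • v - v 2 • u)
  have hxl : x ∈ l.toSubmodule := Submodule.smul_mem _ _
    (Submodule.sub_mem _ (Submodule.smul_mem _ _ hul) (Submodule.smul_mem _ _ hvl))
  have hyl : y ∈ l.toSubmodule := Submodule.smul_mem _ _
    (Submodule.sub_mem _ (Submodule.smul_mem _ _ hvl) (Submodule.smul_mem _ _ hul))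
  have x2 : x 2 = 1 := by simp [x]; rw [inv_mul_eq_one₀ hD]; ring
  have x3 : x 3 = 0 := by simp [x]; right; ring
  have y2 : y 2 = 0 := by simp [y]; right; ring
  have y3 : y 3 = 1 := by simp [y]; rw [inv_mul_eq_one₀ hD]; ring
  refine ⟨ofRows ![x 0, y 0] ![x 1, y 1], ?_⟩
  ext1
  refine Submodule.eq_of_le_of_finrank_eq ?_ (by rw [Grass.finrank_eq, Grass.finrank_eq])
  rintro _ ⟨z, rfl⟩
  have : graphMap stdSplit (ofRows ![x 0, y 0] ![x 1, y 1]) z = z 0 • x + z 1 • y := by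
    ext i
    fin_cases i <;> simp [stdSplit, ofRows_apply, x2, x3, y2, y3, mul_comm]
  rw [this]
  exact Submodule.add_mem _ (Submodule.smul_mem _ _ hxl) (Submodule.smul_mem _ _ hyl)

/-! ### Points of `⟨p₂, p₃⟩` -/

theorem mem_W23 {v : C4} : v ∈ W23 ↔ v 0 = 0 ∧ v 1 = 0 := by
  rw [W23, Submodule.mem_span_pair]
  constructor
  · rintro ⟨a, b, rfl⟩; simp
  · rintro ⟨h0, h1⟩
    refine ⟨v 2, v 3, ?_⟩
    ext i; fin_cases i <;> simp [h0, h1]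

/-- The coordinates `(z₂, z₃)` on `W23`. -/
def w23Equiv : (Fin 2 → ℂ) ≃ₗ[ℂ] W23 where
  toFun x := ⟨stdSplit (x, 0), mem_W23.2 ⟨rfl, rfl⟩⟩
  map_add' x y := by ext i; fin_cases i <;> simp [stdSplit]
  map_smul' c x := by ext i; fin_cases i <;> simp [stdSplit]
  invFun v := ![(v : C4) 2, (v : C4) 3]
  left_inv x := by ext i; fin_cases i <;> simp [stdSplit]
  right_inv v := by
    obtain ⟨v, hv⟩ := v
    obtain ⟨h0, h1⟩ := mem_W23.1 hv
    ext i; fin_cases i <;> simp [stdSplit, h0, h1]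

open Classical in
/-- The point of `⟨p₂, p₃⟩` with homogeneous coordinates `u` (an arbitrary point if `u = 0`). -/
def pt (u : Fin 2 → ℂ) : P23 where
  toSubmodule := Submodule.span ℂ {w23Equiv (if u = 0 then ![1, 0] else u)}
  finrank_eq := by
    refine finrank_span_singleton ?_
    rw [Ne, LinearEquiv.map_eq_zero_iff]
    split_ifs with h
    · exact fun h' => one_ne_zero (congrFun h' 0)
    · exact h

theorem pt_toSubmodule {u : Fin 2 → ℂ} (hu : u ≠ 0) :
    (pt u).toSubmodule = Submodule.span ℂ {w23Equiv u} := by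
  rw [pt]; simp only [if_neg hu]

theorem pt_smul {u : Fin 2 → ℂ} {c : ℂ} (hc : c ≠ 0) : pt (c • u) = pt u := by
  by_cases hu : u = 0
  · rw [hu, smul_zero]
  · ext1
    rw [pt_toSubmodule hu, pt_toSubmodule (smul_ne_zero hc hu), map_smul]
    exact Submodule.span_singleton_smul_eq (IsUnit.mk0 c hc) _

theorem exists_smul_of_pt_eq {u v : Fin 2 → ℂ} (hu : u ≠ 0) (hv : v ≠ 0) (h : pt u = pt v) :
    ∃ c : ℂ, u = c • v := by
  have : w23Equiv u ∈ (pt v).toSubmodule := by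
    rw [← h, pt_toSubmodule hu]; exact Submodule.mem_span_singleton_self _
  rw [pt_toSubmodule hv, Submodule.mem_span_singleton] at this
  obtain ⟨c, hc⟩ := this
  exact ⟨c, w23Equiv.injective (by rw [map_smul, hc])⟩

theorem pt_line {u : Fin 2 → ℂ} (hu : u ≠ 0) :
    (pt u).line = Submodule.span ℂ {stdSplit (u, 0)} := by
  rw [P23.line, pt_toSubmodule hu, Submodule.map_span, image_singleton]; rfl

/-- The splitting of `W23` given by the coordinates `z₂`, `z₃`. -/
def w23Split : ((Fin 1 → ℂ) × (Fin 1 → ℂ)) ≃ₗ[ℂ] W23 where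
  toFun p := w23Equiv ![p.1 0, p.2 0]
  map_add' p q := by rw [← map_add]; congr 1; ext i; fin_cases i <;> simp
  map_smul' c p := by rw [RingHom.id_apply, ← map_smul]; congr 1; ext i; fin_cases i <;> simp
  invFun v := (fun _ => w23Equiv.symm v 0, fun _ => w23Equiv.symm v 1)
  left_inv p := by ext i <;> fin_cases i <;> simp
  right_inv v := by
    rw [← LinearEquiv.eq_symm_apply]
    ext i; fin_cases i <;> simp

section Smooth

variable {F : Type*} [NormedAddCommGroup F] [NormedSpace ℝ F] {H : Type*} [TopologicalSpace H]
  {I : ModelWithCorners ℝ F H} {M : Type*} [TopologicalSpace M] [ChartedSpace H M]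
  {n : WithTop ℕ∞}

/-- A homogeneous coordinate vector is itself a frame of the point, with its two entries as the
frame's components. -/
theorem contMDiffAt_pt {f : M → Fin 2 → ℂ} {x : M} (hf : ContMDiffAt I 𝓘(ℝ, Fin 2 → ℂ) n f x)
    (hx : f x ≠ 0) : ContMDiffAt I 𝓘(ℝ, Model 1 1) n (fun y => pt (f y)) x := by
  have h1 : ∀ i, ContDiff ℝ n (fun u : Fin 2 → ℂ => u i • ContinuousLinearMap.id ℂ (Fin 1 → ℂ)) :=
    fun i => ContDiff.smul (contDiff_apply ℝ ℂ i) contDiff_const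
  refine contMDiffAt_of_frame w23Split ((h1 0).contMDiff.contMDiffAt.comp x hf)
    ((h1 1).contMDiff.contMDiffAt.comp x hf) ?_
  filter_upwards [hf.continuousAt.eventually_ne hx] with y hy
  rw [pt_toSubmodule hy]
  have key : ∀ z : Fin 1 → ℂ, w23Split (f y 0 • z, f y 1 • z) = z 0 • w23Equiv (f y) := by
    intro z
    rw [← map_smul]
    change w23Equiv _ = _
    congr 1
    ext i; fin_cases i <;> simp [mul_comm]
  refine le_antisymm ?_ ?_
  · rw [Submodule.span_singleton_le_iff_mem]
    exact ⟨1, (key 1).trans (one_smul _ _)⟩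
  · rintro _ ⟨z, rfl⟩
    exact Submodule.mem_span_singleton.2 ⟨z 0, (key z).symm⟩

end Smooth

/-- An affine chart has the nowhere vanishing lift `g (1, A 1)`, which is normalized. A global
choice would section the Hopf fibration, so only local ones are available. -/
theorem exists_unit_section (b : P23) : ∃ U : Set P23, IsOpen U ∧ b ∈ U ∧
    ∃ σ : P23 → Fin 2 → ℂ, ContMDiffOn 𝓘(ℝ, Model 1 1) 𝓘(ℝ, Fin 2 → ℂ) ∞ σ U ∧
      ∀ s ∈ U, sqNorm (σ s) = 1 ∧ pt (σ s) = s := by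
  set g := adapted b
  let σ₀ : Model 1 1 → Fin 2 → ℂ := fun A => w23Equiv.symm (g (1, A 1))
  have hσ₀ : ∀ A, σ₀ A ≠ 0 := by
    intro A h
    rw [LinearEquiv.map_eq_zero_iff, LinearEquiv.map_eq_zero_iff] at h
    exact one_ne_zero (congrFun (congrArg Prod.fst h) 0)
  have hpt : ∀ A, pt (σ₀ A) = graphSub g A := by
    intro A
    ext1
    rw [pt_toSubmodule (hσ₀ A), LinearEquiv.apply_symm_apply]
    refine Submodule.eq_of_le_of_finrank_eq ?_ ?_
    · rw [Submodule.span_singleton_le_iff_mem]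
      exact ⟨1, rfl⟩
    · rw [Grass.finrank_eq, finrank_span_singleton]
      intro h
      rw [LinearEquiv.map_eq_zero_iff] at h
      exact one_ne_zero (congrFun (congrArg Prod.fst h) 0)
  have hsm : ContDiff ℂ ω σ₀ := by
    let L : ((Fin 1 → ℂ) × (Fin 1 → ℂ)) →L[ℂ] (Fin 2 → ℂ) :=
      (w23Equiv.symm.toLinearMap ∘ₗ g.toLinearMap).toContinuousLinearMap
    exact L.contDiff.comp (contDiff_const.prodMk (contDiff_id.clm_apply contDiff_const))
  have hsm' : ContDiff ℝ ∞ σ₀ := (hsm.restrict_scalars ℝ).of_le le_top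
  have hcoord : ∀ i, ContDiff ℝ ∞ (fun A => σ₀ A i) := fun i => contDiff_pi.1 hsm' i
  have hnorm : ContDiff ℝ ∞ (fun A => (√(sqNorm (σ₀ A)))⁻¹ • σ₀ A) := by
    have hsq : ContDiff ℝ ∞ (fun A => sqNorm (σ₀ A)) :=
      ((hcoord 0).norm_sq ℝ).add ((hcoord 1).norm_sq ℝ)
    refine ContDiff.smul ((hsq.sqrt fun A => (sqNorm_pos.2 (hσ₀ A)).ne').inv fun A => ?_) hsm'
    exact (Real.sqrt_pos.2 (sqNorm_pos.2 (hσ₀ A))).ne'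
  refine ⟨range (graphSub g), isOpen_range_graphSub g, mem_range_adapted b,
    fun s => (√(sqNorm (σ₀ (graphChart g s))))⁻¹ • σ₀ (graphChart g s),
    hnorm.contMDiff.comp_contMDiffOn (contMDiffOn_graphChart g), ?_⟩
  rintro _ ⟨A, rfl⟩
  simp only [graphChart_graphSub]
  have hpos := sqNorm_pos.2 (hσ₀ A)
  have hsqrt := Real.sqrt_pos.2 hpos
  have hc : (√(sqNorm (σ₀ A)))⁻¹ • σ₀ A = (((√(sqNorm (σ₀ A)))⁻¹ : ℝ) : ℂ) • σ₀ A := by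
    ext i; simp
  rw [hc]
  refine ⟨?_, ?_⟩
  · rw [sqNorm_smul, Complex.norm_real, Real.norm_eq_abs, sq_abs, inv_pow,
      Real.sq_sqrt hpos.le, inv_mul_cancel₀ hpos.ne']
  · rw [pt_smul (Complex.ofReal_ne_zero.2 (inv_ne_zero hsqrt.ne')), hpt]

/-! ### The fibration `τ` -/

/-- The rows of the matrix of a line in the affine chart. -/
def chartRow (l : Gr13) (i : Fin 2) : Fin 2 → ℂ := row (graphChart stdSplit l) i

/-- The map `τ = (s₀, s₁)`. -/
def baseMap (l : Gr13) : P23 × P23 := (pt (perp (chartRow l 1)), pt (perp (chartRow l 0)))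

theorem mem_Gr0_iff {l : Gr13} (hl : l ∈ range (graphSub stdSplit)) : l ∈ Gr0 ↔
    chartRow l 0 ≠ 0 ∧ chartRow l 1 ≠ 0 ∧ ‖det₂ (chartRow l 0) (chartRow l 1)‖ ^ 2 < 1 := by
  conv_lhs => rw [← graphSub_graphChart stdSplit hl]
  exact graphSub_mem_Gr0 _

theorem mu_eq_chartRow {l : Gr13} (hl : l ∈ range (graphSub stdSplit)) :
    mu 0 l = (sqNorm (chartRow l 0) + ‖det₂ (chartRow l 0) (chartRow l 1)‖ ^ 2) /
      (1 + sqNorm (chartRow l 0) + sqNorm (chartRow l 1) +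
        ‖det₂ (chartRow l 0) (chartRow l 1)‖ ^ 2) ∧
    mu 1 l = (sqNorm (chartRow l 1) + ‖det₂ (chartRow l 0) (chartRow l 1)‖ ^ 2) /
      (1 + sqNorm (chartRow l 0) + sqNorm (chartRow l 1) +
        ‖det₂ (chartRow l 0) (chartRow l 1)‖ ^ 2) := by
  have h := mu_graphSub (graphChart stdSplit l)
  rw [graphSub_graphChart stdSplit hl] at h
  exact h

theorem eq_smul_perp {a x : Fin 2 → ℂ} (ha : a ≠ 0) (h : a 0 * x 0 + a 1 * x 1 = 0) :
    ∃ c : ℂ, x = c • perp a := by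
  by_cases h1 : a 1 = 0
  · have h0 : a 0 ≠ 0 := fun h0 => ha (by ext i; fin_cases i <;> simp [h0, h1])
    refine ⟨-(x 1 / a 0), ?_⟩
    rw [h1] at h
    have hx0 : x 0 = 0 := by simpa [h0] using h
    ext i; fin_cases i
    · simp [perp, h1, hx0]
    · simp [perp, h0]
  · refine ⟨x 0 / a 1, ?_⟩
    ext i; fin_cases i
    · simp [perp, h1]
    · simp [perp]
      field_simp
      linear_combination h

/-- Removing its `e i` and `e j` components from the graph vector of `x` leaves a vector of `W23`,
which lies in the span of `e i` and `l` exactly when `A x j = 0`. So the projection from `p i` is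
the kernel of the other row, which explains the swapped rows in `baseMap`. -/
theorem line_eq_inf {l : Gr13} (hl : l ∈ range (graphSub stdSplit)) (i j : Fin 2) (hij : i ≠ j)
    (h : chartRow l j ≠ 0) : (pt (perp (chartRow l j))).line =
      (Submodule.span ℂ {e (Fin.castLE (by norm_num) i)} ⊔ l.toSubmodule) ⊓ W23 := by
  obtain ⟨A, rfl⟩ := hl
  simp only [chartRow, graphChart_graphSub] at h ⊢
  rw [pt_line (perp_ne_zero h)]
  have hgraph : ∀ x, stdSplit (x, 0) =
      stdSplit (x, A x) - A x i • e (Fin.castLE (by norm_num) i) -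
        A x j • e (Fin.castLE (by norm_num) j) := by
    intro x
    ext k
    fin_cases i <;> fin_cases j <;> fin_cases k <;> simp [stdSplit] at hij ⊢
  refine le_antisymm ?_ ?_
  · rw [Submodule.span_singleton_le_iff_mem]
    refine ⟨?_, mem_W23.2 ⟨rfl, rfl⟩⟩
    have hz : A (perp (row A j)) j = 0 := by
      rw [apply_eq_row]; simp [perp]; ring
    rw [hgraph, hz, zero_smul, sub_zero]
    refine Submodule.sub_mem _ (Submodule.mem_sup_right ⟨_, rfl⟩)
      (Submodule.mem_sup_left (Submodule.smul_mem _ _ (Submodule.mem_span_singleton_self _)))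
  · rintro v ⟨hv, hW⟩
    obtain ⟨h0, h1⟩ := mem_W23.1 hW
    obtain ⟨y, hy, z, ⟨x, rfl⟩, rfl⟩ := Submodule.mem_sup.1 hv
    obtain ⟨c, rfl⟩ := Submodule.mem_span_singleton.1 hy
    have hxj : A x j = 0 := by
      fin_cases i <;> fin_cases j <;> simp [stdSplit] at hij h0 h1 ⊢ <;> assumption
    obtain ⟨d, hd⟩ := eq_smul_perp h (by rw [← apply_eq_row]; exact hxj)
    refine Submodule.mem_span_singleton.2 ⟨d, ?_⟩
    rw [← map_smul, Prod.smul_mk, smul_zero, ← hd]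
    ext k
    fin_cases i <;> fin_cases j <;> fin_cases k <;> simp [stdSplit] at hij h0 h1 ⊢ <;>
      first | exact h0.symm | exact h1.symm

theorem torus_smul_graphSub (t : T2) (A : Model 2 2) : t • graphSub stdSplit A =
    graphSub stdSplit (ofRows ((t.1 : ℂ) • row A 0) ((t.2 : ℂ) • row A 1)) := by
  ext1
  refine Submodule.eq_of_le_of_finrank_eq ?_ (by rw [Grass.finrank_eq, Grass.finrank_eq])
  rintro _ ⟨_, ⟨x, rfl⟩, rfl⟩
  refine ⟨x, ?_⟩
  ext k
  fin_cases k <;>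
    simp [stdSplit, ofRows_apply, torusLin, torusDiag, apply_eq_row A x] <;> ring

theorem chartRow_torus_smul (t : T2) {l : Gr13} (hl : l ∈ range (graphSub stdSplit)) :
    t • l ∈ range (graphSub stdSplit) ∧ chartRow (t • l) 0 = (t.1 : ℂ) • chartRow l 0 ∧
      chartRow (t • l) 1 = (t.2 : ℂ) • chartRow l 1 := by
  obtain ⟨A, rfl⟩ := hl
  rw [torus_smul_graphSub]
  simp only [chartRow, graphChart_graphSub, row_ofRows_zero, row_ofRows_one, mem_range_self,
    and_self]

/-- Unit phases on the rows preserve `|det|` and the kernels of the rows. -/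
theorem torus_smul_mem (t : T2) {l : Gr13} (hl : l ∈ Gr0) :
    t • l ∈ Gr0 ∧ baseMap (t • l) = baseMap l := by
  have hr := Gr0_subset_range hl
  obtain ⟨h, e0, e1⟩ := chartRow_torus_smul t hr
  obtain ⟨h0, h1, h2⟩ := (mem_Gr0_iff hr).1 hl
  constructor
  · rw [mem_Gr0_iff h, e0, e1, det₂_smul_smul]
    refine ⟨smul_ne_zero t.1.coe_ne_zero h0, smul_ne_zero t.2.coe_ne_zero h1, ?_⟩
    simpa [Circle.norm_coe] using h2
  · rw [baseMap, baseMap, e0, e1, perp_smul, perp_smul, pt_smul t.1.coe_ne_zero,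
      pt_smul t.2.coe_ne_zero]

/-! ### Openness of `Gr0` and smoothness of `baseMap` and of `mu 0`, `mu 1`. -/

theorem contDiff_row (i : Fin 2) : ContDiff ℝ ∞ (fun A : Model 2 2 => row A i) := by
  have : ContDiff ℂ ω (fun A : Model 2 2 => row A i) := by
    rw [contDiff_pi]
    intro j
    exact contDiff_pi.1 (contDiff_id.clm_apply contDiff_const) i
  exact (this.restrict_scalars ℝ).of_le le_top

theorem contMDiffOn_chartRow (i : Fin 2) :
    ContMDiffOn 𝓘(ℝ, Model 2 2) 𝓘(ℝ, Fin 2 → ℂ) ∞ (fun l => chartRow l i)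
      (range (graphSub stdSplit)) :=
  (contDiff_row i).contMDiff.comp_contMDiffOn (contMDiffOn_graphChart stdSplit)

theorem contDiff_perp : ContDiff ℝ ∞ perp := by
  rw [contDiff_pi]
  intro i
  fin_cases i
  · exact contDiff_apply ℝ ℂ (1 : Fin 2)
  · exact (contDiff_apply ℝ ℂ (0 : Fin 2)).neg

theorem contDiff_sqNorm : ContDiff ℝ ∞ sqNorm :=
  ((contDiff_apply ℝ ℂ (0 : Fin 2)).norm_sq ℝ).add ((contDiff_apply ℝ ℂ (1 : Fin 2)).norm_sq ℝ)

theorem contDiff_det₂ : ContDiff ℝ ∞ (fun p : (Fin 2 → ℂ) × (Fin 2 → ℂ) => det₂ p.1 p.2) := by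
  have h1 : ∀ i : Fin 2, ContDiff ℝ ∞ (fun p : (Fin 2 → ℂ) × (Fin 2 → ℂ) => p.1 i) := fun i =>
    contDiff_pi.1 contDiff_fst i
  have h2 : ∀ i : Fin 2, ContDiff ℝ ∞ (fun p : (Fin 2 → ℂ) × (Fin 2 → ℂ) => p.2 i) := fun i =>
    contDiff_pi.1 contDiff_snd i
  exact ((h1 0).mul (h2 1)).sub ((h1 1).mul (h2 0))

theorem contDiff_herm : ContDiff ℝ ∞ (fun p : (Fin 2 → ℂ) × (Fin 2 → ℂ) => herm p.1 p.2) := by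
  have h1 : ∀ i : Fin 2, ContDiff ℝ ∞ (fun p : (Fin 2 → ℂ) × (Fin 2 → ℂ) => p.1 i) := fun i =>
    contDiff_pi.1 contDiff_fst i
  have h2 : ∀ i : Fin 2, ContDiff ℝ ∞ (fun p : (Fin 2 → ℂ) × (Fin 2 → ℂ) => p.2 i) := fun i =>
    contDiff_pi.1 contDiff_snd i
  have hc : ∀ i : Fin 2, ContDiff ℝ ∞ (fun p : (Fin 2 → ℂ) × (Fin 2 → ℂ) => conj (p.1 i)) :=
    fun i => Complex.conjCLE.contDiff.comp (h1 i)
  exact ((hc 0).mul (h2 0)).add ((hc 1).mul (h2 1))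

theorem isOpen_Gr0 : IsOpen Gr0 := by
  have hopen := isOpen_range_graphSub (E := C4) (k := 2) (m := 2) stdSplit
  have h0 := (contMDiffOn_chartRow 0).continuousOn
  have h1 := (contMDiffOn_chartRow 1).continuousOn
  have h2 : ContinuousOn (fun l => ‖det₂ (chartRow l 0) (chartRow l 1)‖ ^ 2)
      (range (graphSub stdSplit)) :=
    ((contDiff_det₂.continuous.comp_continuousOn (h0.prodMk h1)).norm).pow 2
  have : Gr0 = (range (graphSub stdSplit) ∩ (fun l => chartRow l 0) ⁻¹' {0}ᶜ) ∩
      ((range (graphSub stdSplit) ∩ (fun l => chartRow l 1) ⁻¹' {0}ᶜ) ∩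
      (range (graphSub stdSplit) ∩
        (fun l => ‖det₂ (chartRow l 0) (chartRow l 1)‖ ^ 2) ⁻¹' Iio 1)) := by
    ext l
    constructor
    · intro hl
      have hr := Gr0_subset_range hl
      obtain ⟨e0, e1, e2⟩ := (mem_Gr0_iff hr).1 hl
      exact ⟨⟨hr, e0⟩, ⟨hr, e1⟩, hr, e2⟩
    · rintro ⟨⟨hr, e0⟩, ⟨-, e1⟩, -, e2⟩
      exact (mem_Gr0_iff hr).2 ⟨e0, e1, e2⟩
  rw [this]
  exact (h0.isOpen_inter_preimage hopen isOpen_compl_singleton).inter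
    ((h1.isOpen_inter_preimage hopen isOpen_compl_singleton).inter
      (h2.isOpen_inter_preimage hopen isOpen_Iio))

theorem contMDiffOn_baseMap :
    ContMDiffOn 𝓘(ℝ, Model 2 2) (𝓘(ℝ, Model 1 1).prod 𝓘(ℝ, Model 1 1)) ∞ baseMap Gr0 := by
  have h : ∀ i, ∀ l ∈ Gr0, chartRow l i ≠ 0 → ContMDiffAt 𝓘(ℝ, Model 2 2) 𝓘(ℝ, Model 1 1) ∞
      (fun l => pt (perp (chartRow l i))) l := by
    intro i l hl hi
    exact contMDiffAt_pt (contDiff_perp.contMDiff.contMDiffAt.comp l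
      ((contMDiffOn_chartRow i).contMDiffAt ((isOpen_range_graphSub stdSplit).mem_nhds
        (Gr0_subset_range hl)))) (perp_ne_zero hi)
  intro l hl
  obtain ⟨e0, e1, -⟩ := (mem_Gr0_iff (Gr0_subset_range hl)).1 hl
  exact ((h 1 l hl e1).prodMk (h 0 l hl e0)).contMDiffWithinAt

theorem contMDiffOn_mu : ContMDiffOn 𝓘(ℝ, Model 2 2) 𝓘(ℝ, ℝ × ℝ) ∞
    (fun l : Gr13 => (mu 0 l, mu 1 l)) Gr0 := by
  intro l hl
  have hr := Gr0_subset_range hl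
  have hn : ContDiff ℝ ∞ (fun A : Model 2 2 => sqNorm (row A 0)) := contDiff_sqNorm.comp (contDiff_row 0)
  have hn' : ContDiff ℝ ∞ (fun A : Model 2 2 => sqNorm (row A 1)) := contDiff_sqNorm.comp (contDiff_row 1)
  have hdet : ContDiff ℝ ∞ (fun A : Model 2 2 => ‖det₂ (row A 0) (row A 1)‖ ^ 2) :=
    (contDiff_det₂.comp ((contDiff_row 0).prodMk (contDiff_row 1))).norm_sq ℝ
  have hS : ContDiff ℝ ∞ (fun A : Model 2 2 => 1 + sqNorm (row A 0) + sqNorm (row A 1) +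
      ‖det₂ (row A 0) (row A 1)‖ ^ 2) := ((contDiff_const.add hn).add hn').add hdet
  have hf := ((hn.add hdet).div hS (fun A => (graphSub_normalization_pos A).ne')).prodMk
    ((hn'.add hdet).div hS (fun A => (graphSub_normalization_pos A).ne'))
  refine ContMDiffAt.contMDiffWithinAt ?_
  obtain ⟨A, rfl⟩ := hr
  refine contMDiffAt_of_comp_graphSub stdSplit ?_
  refine hf.contMDiff.contMDiffAt.congr_of_eventuallyEq (Filter.Eventually.of_forall fun B => ?_)
  exact Prod.ext (mu_graphSub B).1 (mu_graphSub B).2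

/-! ### Phases -/

/-- The phase `z / |z|` of a complex number. -/
def phase (z : ℂ) : Circle := Circle.exp z.arg

theorem coe_phase {z : ℂ} (hz : z ≠ 0) : (phase z : ℂ) = z / ‖z‖ := by
  rw [phase, Circle.coe_exp, eq_div_iff (Complex.ofReal_ne_zero.2 (norm_ne_zero_iff.2 hz)),
    mul_comm, Complex.norm_mul_exp_arg_mul_I]

theorem phase_mul_norm {z : ℂ} (hz : z ≠ 0) : (phase z : ℂ) * ‖z‖ = z := by
  rw [coe_phase hz, div_mul_cancel₀ _ (Complex.ofReal_ne_zero.2 (norm_ne_zero_iff.2 hz))]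

theorem phase_circle_mul (t : Circle) {z : ℂ} (hz : z ≠ 0) : phase (t * z) = t * phase z := by
  ext
  rw [coe_phase (mul_ne_zero t.coe_ne_zero hz), Circle.coe_mul, coe_phase hz]
  rw [norm_mul, Circle.norm_coe, one_mul, mul_div_assoc]

theorem phase_pos {r : ℝ} (hr : 0 < r) : phase r = 1 := by
  ext
  rw [coe_phase (Complex.ofReal_ne_zero.2 hr.ne'), Complex.norm_real, Real.norm_eq_abs,
    abs_of_pos hr, div_self (Complex.ofReal_ne_zero.2 hr.ne')]
  rfl

/-- Dividing by `z₀` moves the logarithm to a neighbourhood of `1`, away from its branch cut; this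
gives smoothness of `phase` even where `arg` jumps. -/
theorem phase_eq_exp_log {z₀ z : ℂ} (h₀ : z₀ ≠ 0) (hz : z ≠ 0) :
    phase z = phase z₀ * Circle.exp (Complex.log (z / z₀)).im := by
  ext
  rw [Circle.coe_mul, Circle.coe_exp, coe_phase h₀, coe_phase hz, Complex.log_im]
  have h := Complex.norm_mul_exp_arg_mul_I (z / z₀)
  have hn : ((‖z‖ : ℝ) : ℂ) ≠ 0 := Complex.ofReal_ne_zero.2 (norm_ne_zero_iff.2 hz)
  have hn₀ : ((‖z₀‖ : ℝ) : ℂ) ≠ 0 := Complex.ofReal_ne_zero.2 (norm_ne_zero_iff.2 h₀)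
  rw [norm_div, Complex.ofReal_div] at h
  field_simp at h ⊢
  linear_combination -h

theorem contMDiffAt_phase {z₀ : ℂ} (h₀ : z₀ ≠ 0) : ContMDiffAt 𝓘(ℝ, ℂ) (𝓡 1) ∞ phase z₀ := by
  have hlog : ContDiffAt ℝ ∞ (fun z : ℂ => (Complex.log (z / z₀)).im) z₀ := by
    have h1 : ContDiffAt ℂ ∞ (fun z : ℂ => Complex.log (z / z₀)) z₀ := by
      refine ContDiffAt.comp (g := Complex.log) z₀ (Complex.contDiffAt_log ?_)
        (contDiffAt_id.div_const z₀)
      simp [h₀]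
    exact Complex.imCLM.contDiff.contDiffAt.comp z₀ (h1.restrict_scalars ℝ)
  have hexp : ContMDiff 𝓘(ℝ, ℝ) (𝓡 1) ∞ Circle.exp := contMDiff_circleExp
  have h2 : ContMDiffAt 𝓘(ℝ, ℂ) (𝓡 1) ∞
      (fun z : ℂ => Circle.exp (Complex.log (z / z₀)).im) z₀ :=
    hexp.contMDiffAt.comp z₀ hlog.contMDiffAt
  have hL : LieGroup (𝓡 1) ∞ Circle := LieGroup.of_le (m := ∞) (n := ω) le_top
  have h3 : ContMDiffAt 𝓘(ℝ, ℂ) (𝓡 1) ∞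
      (fun z : ℂ => phase z₀ * Circle.exp (Complex.log (z / z₀)).im) z₀ :=
    contMDiffAt_const.mul h2
  refine h3.congr_of_eventuallyEq ?_
  filter_upwards [isOpen_ne.mem_nhds h₀] with z hz
  exact phase_eq_exp_log h₀ hz

/-! ### Local trivializations of `τ` -/

/-- The parameter `k` of the fibre over the point with unit coordinate vectors `n`. -/
def coupling (n : (Fin 2 → ℂ) × (Fin 2 → ℂ)) : ℝ := ‖det₂ (perp n.2) (perp n.1)‖ ^ 2

theorem coupling_nonneg (n : (Fin 2 → ℂ) × (Fin 2 → ℂ)) : 0 ≤ coupling n := by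
  unfold coupling; positivity

/-- The matrix of the line over the point with unit coordinate vectors `n`, with values `c` of
`(μ̃₀, μ̃₁)` and phases `z`. -/
def fibreModel (n : (Fin 2 → ℂ) × (Fin 2 → ℂ)) (c : ℝ × ℝ) (z : ℂ × ℂ) : Model 2 2 :=
  ofRows ((z.1 * (√(fibreSol₀ (coupling n) c) : ℝ)) • perp n.2)
    ((z.2 * (√(fibreSol₁ (coupling n) c) : ℝ)) • perp n.1)

/-- The complex coordinates of a line with respect to unit coordinate vectors `n` of its image
under `τ`. -/
def fibreCoord (n : (Fin 2 → ℂ) × (Fin 2 → ℂ)) (l : Gr13) : ℂ × ℂ :=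
  (herm (perp n.2) (chartRow l 0), herm (perp n.1) (chartRow l 1))

/-- The rows are unit vectors scaled by `t √p` and `t √q` with the respective phases, so their
squared norms are `p`, `q` and `|det|² = k p q`; `fibreSol_spec` then returns the prescribed values.
This is the right-inverse half of the trivialization. -/
theorem fibreModel_spec {n : (Fin 2 → ℂ) × (Fin 2 → ℂ)} (h0 : sqNorm n.1 = 1) (h1 : sqNorm n.2 = 1)
    {c : ℝ × ℝ} (hc : c ∈ Triangle) (t : T2) :
    graphSub stdSplit (fibreModel n c (t.1, t.2)) ∈ Gr0 ∧
    baseMap (graphSub stdSplit (fibreModel n c (t.1, t.2))) = (pt n.1, pt n.2) ∧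
    (mu 0 (graphSub stdSplit (fibreModel n c (t.1, t.2))),
      mu 1 (graphSub stdSplit (fibreModel n c (t.1, t.2)))) = c ∧
    (phase (fibreCoord n (graphSub stdSplit (fibreModel n c (t.1, t.2)))).1,
      phase (fibreCoord n (graphSub stdSplit (fibreModel n c (t.1, t.2)))).2) = t := by
  have hk := coupling_nonneg n
  have hp := fibreSol₀_pos hk hc
  have hq := fibreSol₁_pos hk hc
  have hspec := fibreSol_spec hk hc
  have r0 : chartRow (graphSub stdSplit (fibreModel n c (t.1, t.2))) 0 =
      (t.1 * (√(fibreSol₀ (coupling n) c) : ℝ) : ℂ) • perp n.2 := by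
    rw [chartRow, graphChart_graphSub, fibreModel, row_ofRows_zero]
  have r1 : chartRow (graphSub stdSplit (fibreModel n c (t.1, t.2))) 1 =
      (t.2 * (√(fibreSol₁ (coupling n) c) : ℝ) : ℂ) • perp n.1 := by
    rw [chartRow, graphChart_graphSub, fibreModel, row_ofRows_one]
  have hmu := mu_eq_chartRow (mem_range_self (f := graphSub stdSplit) (fibreModel n c (t.1, t.2)))
  have hz0 : (t.1 * (√(fibreSol₀ (coupling n) c) : ℝ) : ℂ) ≠ 0 :=
    mul_ne_zero t.1.coe_ne_zero (Complex.ofReal_ne_zero.2 (Real.sqrt_pos.2 hp).ne')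
  have hz1 : (t.2 * (√(fibreSol₁ (coupling n) c) : ℝ) : ℂ) ≠ 0 :=
    mul_ne_zero t.2.coe_ne_zero (Complex.ofReal_ne_zero.2 (Real.sqrt_pos.2 hq).ne')
  have n0 : ‖(t.1 * (√(fibreSol₀ (coupling n) c) : ℝ) : ℂ)‖ ^ 2 = fibreSol₀ (coupling n) c := by
    rw [norm_mul, Circle.norm_coe, one_mul, Complex.norm_real, Real.norm_eq_abs, sq_abs,
      Real.sq_sqrt hp.le]
  have n1 : ‖(t.2 * (√(fibreSol₁ (coupling n) c) : ℝ) : ℂ)‖ ^ 2 = fibreSol₁ (coupling n) c := by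
    rw [norm_mul, Circle.norm_coe, one_mul, Complex.norm_real, Real.norm_eq_abs, sq_abs,
      Real.sq_sqrt hq.le]
  have hdet : ‖det₂ (chartRow (graphSub stdSplit (fibreModel n c (t.1, t.2))) 0)
      (chartRow (graphSub stdSplit (fibreModel n c (t.1, t.2))) 1)‖ ^ 2 =
      coupling n * fibreSol₀ (coupling n) c * fibreSol₁ (coupling n) c := by
    rw [r0, r1, det₂_smul_smul, norm_mul, mul_pow, norm_mul, mul_pow, n0, n1, coupling]; ring
  have hs0 : sqNorm (chartRow (graphSub stdSplit (fibreModel n c (t.1, t.2))) 0) =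
      fibreSol₀ (coupling n) c := by rw [r0, sqNorm_smul, sqNorm_perp, h1, n0, mul_one]
  have hs1 : sqNorm (chartRow (graphSub stdSplit (fibreModel n c (t.1, t.2))) 1) =
      fibreSol₁ (coupling n) c := by rw [r1, sqNorm_smul, sqNorm_perp, h0, n1, mul_one]
  rw [hdet, hs0, hs1, hspec.1, hspec.2] at hmu
  refine ⟨?_, ?_, Prod.ext hmu.1 hmu.2, ?_⟩
  · change 0 < mu 0 _ ∧ 0 < mu 1 _ ∧ mu 0 _ + mu 1 _ < 1
    rw [hmu.1, hmu.2]; exact hc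
  · rw [baseMap, r0, r1, perp_smul, perp_smul, perp_perp, perp_perp, pt_smul hz0, pt_smul hz1]
    have hneg : ∀ u, pt (-u) = pt u := fun u => by
      rw [← neg_one_smul ℂ u, pt_smul (by norm_num)]
    rw [hneg, hneg]
  · rw [fibreCoord, r0, r1, herm_smul, herm_smul, herm_self, herm_self, sqNorm_perp, sqNorm_perp,
      h0, h1]
    simp only [Complex.ofReal_one, mul_one]
    rw [phase_circle_mul _ (Complex.ofReal_ne_zero.2 (Real.sqrt_pos.2 hp).ne'),
      phase_circle_mul _ (Complex.ofReal_ne_zero.2 (Real.sqrt_pos.2 hq).ne'),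
      phase_pos (Real.sqrt_pos.2 hp), phase_pos (Real.sqrt_pos.2 hq), mul_one, mul_one]

/-- A linear form on `ℂ²` is determined by its kernel up to a factor, and the factor is the
Hermitian product with the unit vector `perp n`. -/
theorem chartRow_eq_smul {n : Fin 2 → ℂ} (hn : sqNorm n = 1) {a : Fin 2 → ℂ} (ha : a ≠ 0)
    (h : pt (perp a) = pt n) : a = herm (perp n) a • perp n ∧ herm (perp n) a ≠ 0 := by
  have hn0 : n ≠ 0 := sqNorm_pos.1 (by rw [hn]; exact one_pos)
  obtain ⟨c, hc⟩ := exists_smul_of_pt_eq (perp_ne_zero ha) hn0 h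
  have hac : a = (-c) • perp n := by
    rw [neg_smul, ← perp_smul, ← hc, perp_perp, neg_neg]
  have hh : herm (perp n) a = -c := by
    conv_lhs => rw [hac]
    rw [herm_smul, herm_self, sqNorm_perp, hn]; simp
  rw [hh]
  refine ⟨hac, ?_⟩
  intro h0
  rw [h0, zero_smul] at hac
  exact ha hac

/-- The left-inverse half of the trivialization: by `fibreSol_unique` the values of `mu 0`, `mu 1`
recover the moduli of the two coefficients, and the phases recover the rest. -/
theorem fibreCoord_spec {n : (Fin 2 → ℂ) × (Fin 2 → ℂ)} (h0 : sqNorm n.1 = 1) (h1 : sqNorm n.2 = 1)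
    {l : Gr13} (hl : l ∈ Gr0) (hb : baseMap l = (pt n.1, pt n.2)) :
    chartRow l 0 = (fibreCoord n l).1 • perp n.2 ∧ (fibreCoord n l).1 ≠ 0 ∧
    chartRow l 1 = (fibreCoord n l).2 • perp n.1 ∧ (fibreCoord n l).2 ≠ 0 ∧
    graphSub stdSplit (fibreModel n (mu 0 l, mu 1 l)
      (phase (fibreCoord n l).1, phase (fibreCoord n l).2)) = l := by
  have hr := Gr0_subset_range hl
  obtain ⟨a0, a1, hdet⟩ := (mem_Gr0_iff hr).1 hl
  obtain ⟨e0, z0⟩ := chartRow_eq_smul h1 a0 (congrArg Prod.snd hb)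
  obtain ⟨e1, z1⟩ := chartRow_eq_smul h0 a1 (congrArg Prod.fst hb)
  refine ⟨e0, z0, e1, z1, ?_⟩
  change chartRow l 0 = (fibreCoord n l).1 • perp n.2 at e0
  change chartRow l 1 = (fibreCoord n l).2 • perp n.1 at e1
  change (fibreCoord n l).1 ≠ 0 at z0
  change (fibreCoord n l).2 ≠ 0 at z1
  have hs0 : sqNorm (chartRow l 0) = ‖(fibreCoord n l).1‖ ^ 2 := by
    rw [e0, sqNorm_smul, sqNorm_perp, h1, mul_one]
  have hs1 : sqNorm (chartRow l 1) = ‖(fibreCoord n l).2‖ ^ 2 := by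
    rw [e1, sqNorm_smul, sqNorm_perp, h0, mul_one]
  have hd : ‖det₂ (chartRow l 0) (chartRow l 1)‖ ^ 2 =
      coupling n * ‖(fibreCoord n l).1‖ ^ 2 * ‖(fibreCoord n l).2‖ ^ 2 := by
    rw [e0, e1, det₂_smul_smul, norm_mul, mul_pow, norm_mul, mul_pow, coupling]; ring
  have hmu := mu_eq_chartRow hr
  rw [hs0, hs1, hd] at hmu
  rw [hd] at hdet
  obtain ⟨-, u0, u1⟩ := fibreSol_unique (c := (mu 0 l, mu 1 l)) (coupling_nonneg n)
    (pow_pos (norm_pos_iff.2 z0) 2) (pow_pos (norm_pos_iff.2 z1) 2) hdet hmu.1 hmu.2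
  conv_rhs => rw [← graphSub_graphChart stdSplit hr, ← ofRows_row (graphChart stdSplit l)]
  change _ = graphSub stdSplit (ofRows (chartRow l 0) (chartRow l 1))
  rw [fibreModel, u0, u1, Real.sqrt_sq (norm_nonneg _), Real.sqrt_sq (norm_nonneg _),
    phase_mul_norm z0, phase_mul_norm z1, e0, e1]

theorem fibreCoord_torus_smul (n : (Fin 2 → ℂ) × (Fin 2 → ℂ)) (t : T2) {l : Gr13} (hl : l ∈ Gr0) :
    fibreCoord n (t • l) = (t.1 * (fibreCoord n l).1, t.2 * (fibreCoord n l).2) := by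
  obtain ⟨-, e0, e1⟩ := chartRow_torus_smul t (Gr0_subset_range hl)
  rw [fibreCoord, e0, e1, herm_smul, herm_smul]; rfl

theorem contDiff_ofRows :
    ContDiff ℝ ∞ (fun p : (Fin 2 → ℂ) × (Fin 2 → ℂ) => ofRows p.1 p.2) := by
  have h1 : ∀ i : Fin 2, ContDiff ℝ ∞ (fun p : (Fin 2 → ℂ) × (Fin 2 → ℂ) => p.1 i) := fun i =>
    contDiff_pi.1 contDiff_fst i
  have h2 : ∀ i : Fin 2, ContDiff ℝ ∞ (fun p : (Fin 2 → ℂ) × (Fin 2 → ℂ) => p.2 i) := fun i =>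
    contDiff_pi.1 contDiff_snd i
  exact ((((h1 0).smul contDiff_const).add ((h1 1).smul contDiff_const)).add
    ((h2 0).smul contDiff_const)).add ((h2 1).smul contDiff_const)

theorem contDiff_coupling : ContDiff ℝ ∞ coupling :=
  (contDiff_det₂.comp ((contDiff_perp.comp contDiff_snd).prodMk
    (contDiff_perp.comp contDiff_fst))).norm_sq ℝ

theorem contDiffAt_fibreModel (n : (Fin 2 → ℂ) × (Fin 2 → ℂ)) {c : ℝ × ℝ} (hc : c ∈ Triangle)
    (z : ℂ × ℂ) : ContDiffAt ℝ ∞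
      (fun x : ((Fin 2 → ℂ) × (Fin 2 → ℂ)) × (ℝ × ℝ) × (ℂ × ℂ) => fibreModel x.1 x.2.1 x.2.2)
      (n, c, z) := by
  have hk := coupling_nonneg n
  obtain ⟨s0, s1⟩ := contDiffAt_fibreSol hk hc
  have hn : ContDiffAt ℝ ∞ (fun x : ((Fin 2 → ℂ) × (Fin 2 → ℂ)) × (ℝ × ℝ) × (ℂ × ℂ) => x.1)
    (n, c, z) := contDiffAt_fst
  have hc' : ContDiffAt ℝ ∞ (fun x : ((Fin 2 → ℂ) × (Fin 2 → ℂ)) × (ℝ × ℝ) × (ℂ × ℂ) => x.2.1)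
    (n, c, z) := contDiffAt_snd.fst
  have hz : ContDiffAt ℝ ∞ (fun x : ((Fin 2 → ℂ) × (Fin 2 → ℂ)) × (ℝ × ℝ) × (ℂ × ℂ) => x.2.2)
    (n, c, z) := contDiffAt_snd.snd
  have harg : ContDiffAt ℝ ∞ (fun x : ((Fin 2 → ℂ) × (Fin 2 → ℂ)) × (ℝ × ℝ) × (ℂ × ℂ) =>
    (coupling x.1, x.2.1)) (n, c, z) := (ContDiffAt.comp (g := coupling) (n, c, z) contDiff_coupling.contDiffAt hn).prodMk hc'
  have p0 : ContDiffAt ℝ ∞ (fun x : ((Fin 2 → ℂ) × (Fin 2 → ℂ)) × (ℝ × ℝ) × (ℂ × ℂ) =>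
      fibreSol₀ (coupling x.1) x.2.1) (n, c, z) :=
    ContDiffAt.comp (g := fun w : ℝ × ℝ × ℝ => fibreSol₀ w.1 w.2) (n, c, z)
      (s0.of_le le_top) harg
  have q0 : ContDiffAt ℝ ∞ (fun x : ((Fin 2 → ℂ) × (Fin 2 → ℂ)) × (ℝ × ℝ) × (ℂ × ℂ) =>
      ((√(fibreSol₀ (coupling x.1) x.2.1) : ℝ) : ℂ)) (n, c, z) :=
    ContDiffAt.comp (g := Complex.ofRealCLM) (n, c, z) Complex.ofRealCLM.contDiff.contDiffAt (p0.sqrt (fibreSol₀_pos hk hc).ne')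
  have p1 : ContDiffAt ℝ ∞ (fun x : ((Fin 2 → ℂ) × (Fin 2 → ℂ)) × (ℝ × ℝ) × (ℂ × ℂ) =>
      fibreSol₁ (coupling x.1) x.2.1) (n, c, z) :=
    ContDiffAt.comp (g := fun w : ℝ × ℝ × ℝ => fibreSol₁ w.1 w.2) (n, c, z)
      (s1.of_le le_top) harg
  have q1 : ContDiffAt ℝ ∞ (fun x : ((Fin 2 → ℂ) × (Fin 2 → ℂ)) × (ℝ × ℝ) × (ℂ × ℂ) =>
      ((√(fibreSol₁ (coupling x.1) x.2.1) : ℝ) : ℂ)) (n, c, z) :=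
    ContDiffAt.comp (g := Complex.ofRealCLM) (n, c, z) Complex.ofRealCLM.contDiff.contDiffAt (p1.sqrt (fibreSol₁_pos hk hc).ne')
  have w0 : ContDiffAt ℝ ∞ (fun x : ((Fin 2 → ℂ) × (Fin 2 → ℂ)) × (ℝ × ℝ) × (ℂ × ℂ) =>
      (x.2.2.1 * (√(fibreSol₀ (coupling x.1) x.2.1) : ℝ)) • perp x.1.2) (n, c, z) :=
    (hz.fst.mul q0).smul (ContDiffAt.comp (g := perp) (n, c, z) contDiff_perp.contDiffAt hn.snd)
  have w1 : ContDiffAt ℝ ∞ (fun x : ((Fin 2 → ℂ) × (Fin 2 → ℂ)) × (ℝ × ℝ) × (ℂ × ℂ) =>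
      (x.2.2.2 * (√(fibreSol₁ (coupling x.1) x.2.1) : ℝ)) • perp x.1.1) (n, c, z) :=
    (hz.snd.mul q1).smul (ContDiffAt.comp (g := perp) (n, c, z) contDiff_perp.contDiffAt hn.fst)
  have h := contDiff_ofRows.comp_contDiffAt (n, c, z) (w0.prodMk w1)
  simp only [fibreModel]
  exact h

/-- With local unit vectors `σ` chosen over the base, `fibreCoord` and `fibreModel` are mutually
inverse descriptions of the fibres, both smooth in the base point. -/
theorem exists_trivialization (b : P23 × P23) : ∃ U : Set (P23 × P23), IsOpen U ∧ b ∈ U ∧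
    ∃ Φ : PartialDiffeomorph 𝓘(ℝ, Model 2 2)
        ((𝓘(ℝ, Model 1 1).prod 𝓘(ℝ, Model 1 1)).prod
          (𝓘(ℝ, ℝ × ℝ).prod ((𝓡 1).prod (𝓡 1))))
        Gr13 ((P23 × P23) × ((ℝ × ℝ) × T2)) ∞,
      Φ.source = Gr0 ∩ baseMap ⁻¹' U ∧
      Φ.target = U ×ˢ (Triangle ×ˢ (univ : Set T2)) ∧
      ∀ l ∈ Φ.source, (Φ l).1 = baseMap l ∧ (Φ l).2.1 = (mu 0 l, mu 1 l) ∧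
        ∀ t : T2, (Φ (t • l)).2.2 = t * (Φ l).2.2 := by
  obtain ⟨U₀, hU₀, hb₀, σ₀, hσ₀, hs₀⟩ := exists_unit_section b.1
  obtain ⟨U₁, hU₁, hb₁, σ₁, hσ₁, hs₁⟩ := exists_unit_section b.2
  have hU : IsOpen (U₀ ×ˢ U₁) := hU₀.prod hU₁
  let σ : P23 × P23 → (Fin 2 → ℂ) × (Fin 2 → ℂ) := fun s => (σ₀ s.1, σ₁ s.2)
  have hσ : ContMDiffOn (𝓘(ℝ, Model 1 1).prod 𝓘(ℝ, Model 1 1))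
      𝓘(ℝ, (Fin 2 → ℂ) × (Fin 2 → ℂ)) ∞ σ (U₀ ×ˢ U₁) :=
    (hσ₀.comp contMDiffOn_fst fun _ h => h.1).prodMk_space
      (hσ₁.comp contMDiffOn_snd fun _ h => h.2)
  have hpt : ∀ s ∈ U₀ ×ˢ U₁, (pt (σ s).1, pt (σ s).2) = s := fun s hs =>
    Prod.ext (hs₀ _ hs.1).2 (hs₁ _ hs.2).2
  have hopen : IsOpen (Gr0 ∩ baseMap ⁻¹' (U₀ ×ˢ U₁)) :=
    contMDiffOn_baseMap.continuousOn.isOpen_inter_preimage isOpen_Gr0 hU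
  refine ⟨U₀ ×ˢ U₁, hU, ⟨hb₀, hb₁⟩, ?_⟩
  let F : Gr13 → (P23 × P23) × ((ℝ × ℝ) × T2) := fun l =>
    (baseMap l, ((mu 0 l, mu 1 l), (phase (fibreCoord (σ (baseMap l)) l).1,
      phase (fibreCoord (σ (baseMap l)) l).2)))
  let G : (P23 × P23) × ((ℝ × ℝ) × T2) → Gr13 := fun x =>
    graphSub stdSplit (fibreModel (σ x.1) x.2.1 (x.2.2.1, x.2.2.2))
  have hGspec : ∀ x ∈ (U₀ ×ˢ U₁) ×ˢ (Triangle ×ˢ (univ : Set T2)),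
      G x ∈ Gr0 ∧ baseMap (G x) = x.1 ∧ F (G x) = x := by
    rintro ⟨s, c, t⟩ ⟨hs, hc, -⟩
    obtain ⟨h1, h2, h3, h4⟩ := fibreModel_spec (n := σ s) (hs₀ _ hs.1).1 (hs₁ _ hs.2).1 hc t
    rw [hpt s hs] at h2
    refine ⟨h1, h2, ?_⟩
    change (baseMap (G (s, c, t)), _) = _
    have h2' : baseMap (G (s, c, t)) = s := h2
    simp only [h2']
    exact Prod.ext rfl (Prod.ext h3 h4)
  have hF : ContMDiffOn 𝓘(ℝ, Model 2 2) ((𝓘(ℝ, Model 1 1).prod 𝓘(ℝ, Model 1 1)).prod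
      (𝓘(ℝ, ℝ × ℝ).prod ((𝓡 1).prod (𝓡 1)))) ∞ F (Gr0 ∩ baseMap ⁻¹' (U₀ ×ˢ U₁)) := by
    have hn : ContMDiffOn 𝓘(ℝ, Model 2 2) 𝓘(ℝ, (Fin 2 → ℂ) × (Fin 2 → ℂ)) ∞
        (fun l => σ (baseMap l)) (Gr0 ∩ baseMap ⁻¹' (U₀ ×ˢ U₁)) :=
      hσ.comp (contMDiffOn_baseMap.mono inter_subset_left) fun l hl => hl.2
    have hrow : ∀ i, ContMDiffOn 𝓘(ℝ, Model 2 2) 𝓘(ℝ, Fin 2 → ℂ) ∞ (fun l => chartRow l i)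
        (Gr0 ∩ baseMap ⁻¹' (U₀ ×ˢ U₁)) := fun i =>
      (contMDiffOn_chartRow i).mono (inter_subset_left.trans Gr0_subset_range)
    have c0 : ContMDiffOn 𝓘(ℝ, Model 2 2) 𝓘(ℝ, ℂ) ∞
        (fun l => (fibreCoord (σ (baseMap l)) l).1) (Gr0 ∩ baseMap ⁻¹' (U₀ ×ˢ U₁)) :=
      contDiff_herm.contMDiff.comp_contMDiffOn
        (((contDiff_perp.comp contDiff_snd).contMDiff.comp_contMDiffOn hn).prodMk_space (hrow 0))
    have c1 : ContMDiffOn 𝓘(ℝ, Model 2 2) 𝓘(ℝ, ℂ) ∞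
        (fun l => (fibreCoord (σ (baseMap l)) l).2) (Gr0 ∩ baseMap ⁻¹' (U₀ ×ˢ U₁)) :=
      contDiff_herm.contMDiff.comp_contMDiffOn
        (((contDiff_perp.comp contDiff_fst).contMDiff.comp_contMDiffOn hn).prodMk_space (hrow 1))
    refine (contMDiffOn_baseMap.mono inter_subset_left).prodMk
      ((contMDiffOn_mu.mono inter_subset_left).prodMk (ContMDiffOn.prodMk ?_ ?_))
    -- `phase` is smooth only away from zero; the coefficient is nonzero because the row is.
    · intro l hl
      obtain ⟨-, z0, -, -, -⟩ := fibreCoord_spec (n := σ (baseMap l)) (hs₀ _ hl.2.1).1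
        (hs₁ _ hl.2.2).1 hl.1 (hpt _ hl.2).symm
      exact ContMDiffAt.comp_contMDiffWithinAt (g := phase) l (contMDiffAt_phase z0) (c0 l hl)
    · intro l hl
      obtain ⟨-, -, -, z1, -⟩ := fibreCoord_spec (n := σ (baseMap l)) (hs₀ _ hl.2.1).1
        (hs₁ _ hl.2.2).1 hl.1 (hpt _ hl.2).symm
      exact ContMDiffAt.comp_contMDiffWithinAt (g := phase) l (contMDiffAt_phase z1) (c1 l hl)
  have hG : ContMDiffOn ((𝓘(ℝ, Model 1 1).prod 𝓘(ℝ, Model 1 1)).prod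
      (𝓘(ℝ, ℝ × ℝ).prod ((𝓡 1).prod (𝓡 1)))) 𝓘(ℝ, Model 2 2) ∞ G
      ((U₀ ×ˢ U₁) ×ˢ (Triangle ×ˢ (univ : Set T2))) := by
    let J := (𝓘(ℝ, Model 1 1).prod 𝓘(ℝ, Model 1 1)).prod (𝓘(ℝ, ℝ × ℝ).prod ((𝓡 1).prod (𝓡 1)))
    have a1 : ContMDiffOn J 𝓘(ℝ, (Fin 2 → ℂ) × (Fin 2 → ℂ)) ∞
        (fun x : (P23 × P23) × ((ℝ × ℝ) × T2) => σ x.1)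
        ((U₀ ×ˢ U₁) ×ˢ (Triangle ×ˢ (univ : Set T2))) :=
      hσ.comp contMDiffOn_fst fun x hx => hx.1
    have a2 : ContMDiff J 𝓘(ℝ, ℝ × ℝ) ∞
        (fun x : (P23 × P23) × ((ℝ × ℝ) × T2) => x.2.1) := contMDiff_snd.fst
    have a3 : ContMDiff J 𝓘(ℝ, ℂ) ∞
        (fun x : (P23 × P23) × ((ℝ × ℝ) × T2) => (x.2.2.1 : ℂ)) :=
      contMDiff_circle_coe.comp contMDiff_snd.snd.fst
    have a4 : ContMDiff J 𝓘(ℝ, ℂ) ∞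
        (fun x : (P23 × P23) × ((ℝ × ℝ) × T2) => (x.2.2.2 : ℂ)) :=
      contMDiff_circle_coe.comp contMDiff_snd.snd.snd
    have a5 := a1.prodMk_space (a2.contMDiffOn.prodMk_space
      (a3.contMDiffOn.prodMk_space a4.contMDiffOn))
    intro x hx
    exact (contMDiff_graphSub stdSplit).contMDiffAt.comp_contMDiffWithinAt x
      (((contDiffAt_fibreModel (σ x.1) hx.2.1 (x.2.2.1, x.2.2.2)).contMDiffAt).comp_contMDiffWithinAt
        x (a5 x hx))
  let Φ : PartialDiffeomorph 𝓘(ℝ, Model 2 2) ((𝓘(ℝ, Model 1 1).prod 𝓘(ℝ, Model 1 1)).prod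
      (𝓘(ℝ, ℝ × ℝ).prod ((𝓡 1).prod (𝓡 1)))) Gr13 ((P23 × P23) × ((ℝ × ℝ) × T2)) ∞ :=
    { toFun := F
      invFun := G
      source := Gr0 ∩ baseMap ⁻¹' (U₀ ×ˢ U₁)
      target := (U₀ ×ˢ U₁) ×ˢ (Triangle ×ˢ (univ : Set T2))
      map_source' := fun l hl => ⟨hl.2, hl.1, mem_univ _⟩
      map_target' := fun x hx => ⟨(hGspec x hx).1, by
        rw [mem_preimage, (hGspec x hx).2.1]; exact hx.1⟩
      left_inv' := fun l hl => (fibreCoord_spec (n := σ (baseMap l)) (hs₀ _ hl.2.1).1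
        (hs₁ _ hl.2.2).1 hl.1 (hpt _ hl.2).symm).2.2.2.2
      right_inv' := fun x hx => (hGspec x hx).2.2
      open_source := hopen
      open_target := by
        refine hU.prod (IsOpen.prod ?_ isOpen_univ)
        exact (isOpen_lt continuous_const continuous_fst).inter
          ((isOpen_lt continuous_const continuous_snd).inter
            (isOpen_lt (continuous_fst.add continuous_snd) continuous_const))
      contMDiffOn_toFun := hF
      contMDiffOn_invFun := hG }
  refine ⟨Φ, rfl, rfl, fun l hl => ⟨rfl, rfl, fun t => ?_⟩⟩
  obtain ⟨-, z0, -, z1, -⟩ := fibreCoord_spec (n := σ (baseMap l)) (hs₀ _ hl.2.1).1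
    (hs₁ _ hl.2.2).1 hl.1 (hpt _ hl.2).symm
  change (phase (fibreCoord (σ (baseMap (t • l))) (t • l)).1,
    phase (fibreCoord (σ (baseMap (t • l))) (t • l)).2) = _
  -- Invariance of `baseMap` means that the same unit vectors are used at `t • l`, so the
  -- coefficients are just multiplied by `t.1` and `t.2`.
  rw [(torus_smul_mem t hl.1).2, fibreCoord_torus_smul _ t hl.1, phase_circle_mul _ z0,
    phase_circle_mul _ z1]
  rfl

/-! ### The invariant tori -/

theorem mu_torus_smul (t : T2) {l : Gr13} (hl : l ∈ Gr0) :
    mu 0 (t • l) = mu 0 l ∧ mu 1 (t • l) = mu 1 l := by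
  have hr := Gr0_subset_range hl
  obtain ⟨h, e0, e1⟩ := chartRow_torus_smul t hr
  have hmu := mu_eq_chartRow h
  rw [e0, e1, det₂_smul_smul, sqNorm_smul, sqNorm_smul] at hmu
  simp only [norm_mul, Circle.norm_coe, one_mul, one_pow] at hmu
  obtain ⟨m0, m1⟩ := mu_eq_chartRow hr
  rw [m0, m1]
  exact hmu

theorem finrank_real_model (k m : ℕ) : finrank ℝ (Model k m) = 2 * (k * m) := by
  rw [finrank_real_of_complex, ← (LinearMap.toContinuousLinearMap (𝕜 := ℂ) (E := Fin k → ℂ)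
    (F' := Fin m → ℂ)).finrank_eq, finrank_linearMap]
  simp

/-- The model space of the base and the triangle. -/
abbrev TorusComplement : Type := (Model 1 1 × Model 1 1) × (ℝ × ℝ)

/-- The model space of the torus. -/
abbrev TorusModel : Type := EuclideanSpace ℝ (Fin 1) × EuclideanSpace ℝ (Fin 1)

/-- Both sides have real dimension 8, namely 2 + (4 + 2) and 2 · 4; any linear isomorphism serves.
-/
theorem nonempty_torusSplitting : Nonempty ((TorusModel × TorusComplement) ≃L[ℝ] Model 2 2) := by
  refine ⟨ContinuousLinearEquiv.ofFinrankEq ?_⟩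
  simp only [finrank_prod, finrank_real_model, finrank_euclideanSpace_fin, finrank_self]

/-- The affine isomorphism of the model space of the local trivialization with the model space of
the Grassmannian that sends the slice through `v₀` to the image of `TorusModel × 0`. -/
def sliceHomeomorph (L : (TorusModel × TorusComplement) ≃L[ℝ] Model 2 2) (v₀ : TorusComplement) :
    ((Model 1 1 × Model 1 1) × ((ℝ × ℝ) × TorusModel)) ≃ₜ Model 2 2 where
  toFun v := L (v.2.2, (v.1 - v₀.1, v.2.1 - v₀.2))
  invFun w := ((L.symm w).2.1 + v₀.1, ((L.symm w).2.2 + v₀.2, (L.symm w).1))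
  left_inv v := by simp
  right_inv w := by simp
  continuous_toFun := by fun_prop
  continuous_invFun := by fun_prop

/-- The torus is the slice of a local trivialization over `b` with triangle coordinate `c`; its
properties are those of the slice, transported by `Φ`. -/
theorem exists_torus (b : P23 × P23) {c : ℝ × ℝ} (hc : c ∈ Triangle) : ∃ f : T2 → Gr13,
    Manifold.IsSmoothEmbedding ((𝓡 1).prod (𝓡 1)) 𝓘(ℝ, Model 2 2) ∞ f ∧
    range f = {l | l ∈ Gr0 ∧ baseMap l = b ∧ (mu 0 l, mu 1 l) = c} ∧
    ∀ t x : T2, f (t * x) = t • f x := by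
  obtain ⟨U, hU, hb, Φ, hsource, htarget, hΦ⟩ := exists_trivialization b
  have hmem : ∀ t : T2, (b, (c, t)) ∈ Φ.target := fun t => by
    rw [htarget]; exact ⟨hb, hc, mem_univ _⟩
  let f : T2 → Gr13 := fun t => Φ.symm (b, (c, t))
  have hfs : ∀ t, f t ∈ Φ.source := fun t => Φ.map_target (hmem t)
  have hΦf : ∀ t, Φ (f t) = (b, (c, t)) := fun t => Φ.right_inv (hmem t)
  have hf0 : ∀ t, f t ∈ Gr0 := fun t => (hsource ▸ hfs t : f t ∈ Gr0 ∩ baseMap ⁻¹' U).1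
  have hfb : ∀ t, baseMap (f t) = b := fun t => by rw [← (hΦ _ (hfs t)).1, hΦf]
  have hfc : ∀ t, (mu 0 (f t), mu 1 (f t)) = c := fun t => by rw [← (hΦ _ (hfs t)).2.1, hΦf]
  have hcont : Continuous f := by
    have h1 : Continuous fun t : T2 => (b, (c, t)) := by fun_prop
    exact Φ.contMDiffOn_invFun.continuousOn.comp_continuous h1 hmem
  refine ⟨f, ⟨?_, ?_⟩, ?_, ?_⟩
  · obtain ⟨L⟩ := nonempty_torusSplitting
    refine Manifold.IsImmersionOfComplement.isImmersion (F := TorusComplement) fun t₀ => ?_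
    -- For the immersion a chart of the Grassmannian is needed in which `f` is the linear inclusion
    -- `u ↦ L (u, 0)`: it is `Φ`, then a product chart, then `sliceHomeomorph`.
    let y₀ : (P23 × P23) × ((ℝ × ℝ) × T2) := (b, (c, t₀))
    let K := (𝓘(ℝ, Model 1 1).prod 𝓘(ℝ, Model 1 1)).prod
      (𝓘(ℝ, ℝ × ℝ).prod ((𝓡 1).prod (𝓡 1)))
    let e₁ : OpenPartialHomeomorph ((P23 × P23) × ((ℝ × ℝ) × T2))
      ((Model 1 1 × Model 1 1) × ((ℝ × ℝ) × TorusModel)) :=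
      chartAt (ModelProd (ModelProd (Model 1 1) (Model 1 1)) (ModelProd (ℝ × ℝ)
        (ModelProd (EuclideanSpace ℝ (Fin 1)) (EuclideanSpace ℝ (Fin 1))))) y₀
    -- The base and triangle coordinates of the slice in the product chart, subtracted so that the
    -- slice lands on zero; the chart of `ℝ × ℝ` is the identity, whence `c` itself.
    let v₀ : TorusComplement := ((e₁ y₀).1, c)
    let ψ : OpenPartialHomeomorph Gr13 (Model 2 2) :=
      (Φ.toOpenPartialHomeomorph.trans e₁).trans
        (sliceHomeomorph L v₀).toOpenPartialHomeomorph
    have hψ : ψ ∈ IsManifold.maximalAtlas 𝓘(ℝ, Model 2 2) ∞ Gr13 := by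
      refine ψ.mem_maximalAtlas_of_contMDiffOn ?_ ?_
      · have h1 : ContMDiffOn K 𝓘(ℝ, (Model 1 1 × Model 1 1) × ((ℝ × ℝ) × TorusModel)) ∞ e₁
          e₁.source := contMDiffOn_extChartAt (I := K) (x := y₀)
        have h2 : ContDiff ℝ ∞ (sliceHomeomorph L v₀) := by
          refine L.contDiff.comp ?_
          fun_prop
        have h3 := h2.contMDiff.comp_contMDiffOn (h1.comp
          (Φ.contMDiffOn_toFun.mono inter_subset_left) fun l hl => hl.2)
        refine h3.mono ?_
        intro l hl
        simpa [ψ] using hl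
      · have h1 : ContMDiffOn 𝓘(ℝ, (Model 1 1 × Model 1 1) × ((ℝ × ℝ) × TorusModel)) K ∞ e₁.symm
          e₁.target := by
          refine (contMDiffOn_extChartAt_symm (I := K) (n := ∞) y₀).mono fun v hv => ?_
          rw [extChartAt_target]
          exact ⟨hv, v, rfl⟩
        have h2 : ContDiff ℝ ∞ (sliceHomeomorph L v₀).symm := by
          have : ContDiff ℝ ∞ L.symm := L.symm.contDiff
          change ContDiff ℝ ∞ fun w => ((L.symm w).2.1 + v₀.1, ((L.symm w).2.2 + v₀.2, (L.symm w).1))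
          fun_prop
        have h3 := (Φ.contMDiffOn_invFun.comp (h1.mono inter_subset_left)
          fun v (hv : v ∈ e₁.target ∩ e₁.symm ⁻¹' Φ.target) => hv.2).comp h2.contMDiff.contMDiffOn
          (s := (sliceHomeomorph L v₀).symm ⁻¹' (e₁.target ∩ e₁.symm ⁻¹' Φ.target)) fun w hw => hw
        exact h3.mono fun w hw => hw.2
    let φ : OpenPartialHomeomorph T2
      (ModelProd (EuclideanSpace ℝ (Fin 1)) (EuclideanSpace ℝ (Fin 1))) := chartAt _ t₀
    have hψs : φ.source ⊆ f ⁻¹' ψ.source := by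
      intro t ht
      refine ⟨⟨hfs t, ?_⟩, mem_univ _⟩
      change Φ (f t) ∈ e₁.source
      rw [hΦf]
      exact ⟨⟨mem_chart_source _ b.1, mem_chart_source _ b.2⟩, mem_univ _, ht⟩
    refine Manifold.IsImmersionAtOfComplement.mk_of_charts L φ ψ
      (mem_chart_source _ t₀) ?_ (IsManifold.chart_mem_maximalAtlas t₀) hψ ?_ ?_
    · exact hψs (mem_chart_source _ t₀)
    · exact hψs
    · intro u hu
      have hu' : u ∈ φ.target := by
        rw [OpenPartialHomeomorph.extend_target] at hu
        exact hu.1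
      change sliceHomeomorph L v₀ (e₁ (Φ (f (φ.symm u)))) = L (u, 0)
      rw [hΦf]
      change L (φ (φ.symm u), ((e₁ y₀).1 - (e₁ y₀).1, c - c)) = _
      rw [φ.right_inv hu', sub_self, sub_self]
      rfl
  -- The torus component of `Φ` is a continuous left inverse on the source, which makes `f` a
  -- topological embedding.
  · let f' : T2 → Φ.source := fun t => ⟨f t, hfs t⟩
    let h : Φ.source → T2 := fun l => (Φ l).2.2
    have hh : Continuous h :=
      (continuousOn_iff_continuous_domRestrict.1 Φ.contMDiffOn_toFun.continuousOn).snd.snd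
    have hinv : Function.LeftInverse h f' := fun t => by
      change (Φ (f t)).2.2 = t
      rw [hΦf]
    exact Topology.IsEmbedding.subtypeVal.comp
      (hinv.isEmbedding hh (hcont.subtype_mk hfs))
  · ext l
    constructor
    · rintro ⟨t, rfl⟩
      exact ⟨hf0 t, hfb t, hfc t⟩
    · rintro ⟨h0, h1, h2⟩
      have hs : l ∈ Φ.source := by rw [hsource]; exact ⟨h0, by rw [mem_preimage, h1]; exact hb⟩
      refine ⟨(Φ l).2.2, ?_⟩
      have : Φ l = (b, (c, (Φ l).2.2)) :=
        Prod.ext ((hΦ l hs).1.trans h1) (Prod.ext ((hΦ l hs).2.1.trans h2) rfl)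
      change Φ.symm (b, (c, (Φ l).2.2)) = l
      rw [← this]
      exact Φ.left_inv hs
  · intro t x
    obtain ⟨m0, mb⟩ := torus_smul_mem t (hf0 x)
    have hs : t • f x ∈ Φ.source := by
      rw [hsource]; exact ⟨m0, by rw [mem_preimage, mb, hfb]; exact hb⟩
    -- The action fixes the base point and both values of `mu` and translates the phases, so `Φ`
    -- sends both sides to the same point.
    have : Φ (t • f x) = (b, (c, t * x)) := by
      refine Prod.ext ((hΦ _ hs).1.trans (mb.trans (hfb x))) (Prod.ext ?_ ?_)
      · rw [(hΦ _ hs).2.1, (mu_torus_smul t (hf0 x)).1, (mu_torus_smul t (hf0 x)).2]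
        exact hfc x
      · rw [(hΦ _ (hfs x)).2.2 t, hΦf]
    change Φ.symm (b, (c, t * x)) = _
    rw [← this]
    exact Φ.left_inv hs

end LineGrass

end

open LineGrass
theorem mainTheorem6 :
    -- `T²` acts smoothly on `Gr(1,3)`; its two circles are the Hamiltonian flows of `μ̃₀`, `μ̃₁`
    ContMDiff (((𝓡 1).prod (𝓡 1)).prod 𝓘(ℝ, Model 2 2)) 𝓘(ℝ, Model 2 2) ∞
      (fun q : T2 × Gr13 => q.1 • q.2) ∧
    (∀ i : Fin 2, ∃ X : ∀ l : Gr13, TangentSpace 𝓘(ℝ, Model 2 2) l,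
      IsHamiltonianField (mu (Fin.castLE (by norm_num) i)) X ∧
      ∀ l : Gr13, IsMIntegralCurve (I := 𝓘(ℝ, Model 2 2)) (fun θ : ℝ => oneParam i θ • l) X) ∧
    IsOpen Gr0 ∧
    ∃ τ : Gr13 → P23 × P23,
      -- on `Gr⁰(1,3)`, `τ l = (s₀, s₁)` where `{s i} = ⟨p i, l⟩ ∩ ⟨p₂, p₃⟩`
      (∀ l ∈ Gr0,
        (τ l).1.line = (Submodule.span ℂ {e 0} ⊔ l.toSubmodule) ⊓ W23 ∧
        (τ l).2.line = (Submodule.span ℂ {e 1} ⊔ l.toSubmodule) ⊓ W23) ∧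
      -- `τ` is a smooth locally trivial fibration of `Gr⁰(1,3)` over the product, with
      -- fibre (open triangle) × `T²`; the triangle coordinate is `(μ̃₀, μ̃₁)`
      (∀ b : P23 × P23, ∃ U : Set (P23 × P23), IsOpen U ∧ b ∈ U ∧
        ∃ Φ : PartialDiffeomorph 𝓘(ℝ, Model 2 2)
            ((𝓘(ℝ, Model 1 1).prod 𝓘(ℝ, Model 1 1)).prod
              (𝓘(ℝ, ℝ × ℝ).prod ((𝓡 1).prod (𝓡 1))))
            Gr13 ((P23 × P23) × ((ℝ × ℝ) × T2)) ∞,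
          Φ.source = Gr0 ∩ τ ⁻¹' U ∧
          Φ.target = U ×ˢ (Triangle ×ˢ (univ : Set T2)) ∧
          ∀ l ∈ Φ.source, (Φ l).1 = τ l ∧ (Φ l).2.1 = (mu 0 l, mu 1 l) ∧
            ∀ t : T2, (Φ (t • l)).2.2 = t * (Φ l).2.2) ∧
      -- the torus action preserves `Gr⁰(1,3)`, fixes the base and maps each fibre to itself
      (∀ (t : T2), ∀ l ∈ Gr0, t • l ∈ Gr0 ∧ τ (t • l) = τ l) ∧
      -- over each point of the base, each joint level set is a smoothly embedded two-torus,
      -- on which `T²` acts by translations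
      (∀ (b : P23 × P23), ∀ c ∈ Triangle, ∃ f : T2 → Gr13,
        Manifold.IsSmoothEmbedding ((𝓡 1).prod (𝓡 1)) 𝓘(ℝ, Model 2 2) ∞ f ∧
        range f = {l | l ∈ Gr0 ∧ τ l = b ∧ (mu 0 l, mu 1 l) = c} ∧
        ∀ t x : T2, f (t * x) = t • f x) := by
  refine ⟨contMDiff_torus_smul, fun i => ⟨generator i, isHamiltonianField_generator i,
    isMIntegralCurve_orbit i⟩, isOpen_Gr0, baseMap, fun l hl => ?_, exists_trivialization,
    fun t l hl => torus_smul_mem t hl, fun b c hc => exists_torus b hc⟩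
  have hr := Gr0_subset_range hl
  obtain ⟨h0, h1, -⟩ := (mem_Gr0_iff hr).1 hl
  exact ⟨line_eq_inf hr 0 1 zero_ne_one h1, line_eq_inf hr 1 0 one_ne_zero h0⟩
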